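/- **Theorem A.1.** Let $d\ge 2$, let $B_1\subset\mathbb R^d$ be the unit ball, and let $\alpha>0$, $p\ge 2$, $\beta\in[0,1)$, $T_{\max}>0$, $C_{SL},C_{LS},C_{ED}>0$ be constants with $$(1+\beta)\Bigl(1-\frac1p\Bigr)<1 .$$ Then $\gamma:=(1+\beta)(2-\frac2p)-1$ belongs to $[0,1)$, and there are constants $E>0$ and $\varepsilon>0$, depending only on $d,\alpha,p,\beta,T_{\max},C_{SL},C_{LS},C_{ED}$, such that the following holds. Suppose given functionals $\mathcal G:H^1(B_1)\to\mathbb R$ and $\mathcal F:H^1(\partial B_1)\to\mathbb R$, a set $\mathcal S$ and a flow $\psi$ with the following properties. * *Differentiability.* There is a map $\nabla\mathcal F:H^2(\partial B_1)\to L^2(\partial B_1)$ such that $\mathcal F(u+v)=\mathcal F(u)+\int_{\partial B_1}v\,\nabla\mathcal F(u)+o(\|v\|_{H^1(\partial B_1)})$ for all $u\in H^2(\partial B_1)$, $v\in H^1(\partial B_1)$. * *Slicing.* If $u=u(r,\theta)\in H^1([0,1]\times\partial B_1)$ is such that $r^\alpha u\in H^1(B_1)$ and $r\mapsto\mathcal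 F(u(r,\cdot))\,r^{2\alpha+d-3}$ is integrable on $(0,1)$, then $$\mathcal G(r^\alpha u)\le\int_0^1\mathcal F(u(r,\cdot))\,r^{2\alpha+d-3}\,dr+C_{SL}\int_0^1\!\int_{\partial B_1}|\partial_ru|^2\,r^{2\alpha+d-1}\,d\mathcal H^{d-1}dr ,$$ with equality if $u$ does not depend on $r$. * *Critical set.* $\mathcal S\subset H^2(\partial B_1)$ is compact and non-empty, $\nabla\mathcal F(Q)=0$ for every $Q\in\mathcal S$, and $\mathcal F$ is constant on $\mathcal S$; its value there is denoted by $\mathcal F(\mathcal S)$, and $\mathcal G(\mathcal S):=\frac1{2\alpha+d-2}\mathcal F(\mathcal S)$. * *Flow.* $\psi:[0,T_{\max}]\to H^1(\partial B_1)$ is such that either $\psi\in L^2((0,T_{\max});H^2(\partial B_1))\cap H^1((0,T_{\max});L^2(\partial B_1))$, or $\psi\in H^1((0,T_{\max});H^1(\partial B_1))$ and $\mathcal F$ is (Fréchet) differentiable at $\psi(t)$ for every $t\in(0,T_{\max})$. In both cases $\psi(t)-\psi(s)=\int_s^t\psi'(\tau)\,d\tau$ in $L^2(\partial B_1)$ for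 all $0\le s\le t\le T_{\max}$. Write $\psi'(t)\cdot\nabla\mathcal F(\psi(t))$ for the scalar product in $L^2(\partial B_1)$ in the first case and for the derivative of $\mathcal F$ at $\psi(t)$ in the direction $\psi'(t)$ in the second. The energy is weakly differentiable along the flow: $t\mapsto\psi'(t)\cdot\nabla\mathcal F(\psi(t))$ is integrable on $(0,T_{\max})$ and $\mathcal F(\psi(t))-\mathcal F(\psi(s))=\int_s^t\psi'(\tau)\cdot\nabla\mathcal F(\psi(\tau))\,d\tau$ for all $0\le s\le t\le T_{\max}$. * *Energy dissipation.* For almost every $t\in(0,T_{\max})$, $\;C_{ED}\min\{\|\psi'(t)\|_{L^2(\partial B_1)}^2,\|\psi'(t)\|_{L^2(\partial B_1)}^p\}\le-\psi'(t)\cdot\nabla\mathcal F(\psi(t))$. * *Łojasiewicz inequality.* For almost every $t\in(0,T_{\max})$ with $\mathcal F(\psi(t))\ge\mathcal F(\mathcal S)$, $\;C_{LS}\,(\mathcal F(\psi(t))-\mathcal F(\mathcal S))^{1+\beta}\le-\psi'(t)\cdot\nabla\mathcal F(\psi(t))$. If $c=\psi(0)$ satisfies $\mathcal F(c)-\mathcal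 F(\mathcal S)\le E$, then $z(r,\theta):=r^\alpha c(\theta)$ belongs to $H^1(B_1)$, and there is a function $h\in H^1(B_1)$ with $h=c$ on $\partial B_1$ (in the sense of traces) and $$\mathcal G(h)-\mathcal G(\mathcal S)\le\bigl(1-\varepsilon\,|\mathcal G(z)-\mathcal G(\mathcal S)|^{\gamma}\bigr)\bigl(\mathcal G(z)-\mathcal G(\mathcal S)\bigr).$$ Moreover, $h$ can be taken of the form $h(r,\theta)=r^\alpha\,\psi(\min\{-\kappa\ln r,\,T\})(\theta)$ for some $\kappa>0$ and $T\in[0,T_{\max}]$. -/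

import Mathlib

open MeasureTheory Set
open scoped ContDiff

noncomputable section

namespace LogEpi

/-- The ambient Euclidean space `ℝ^d`. -/
abbrev Euc (d : ℕ) : Type := EuclideanSpace ℝ (Fin d)

/-- The unit sphere `∂B₁` of `ℝ^d`. -/
abbrev Sph (d : ℕ) : Type := Metric.sphere (0 : Euc d) 1

/-- The surface measure of `∂B₁`. It is normalized so that
`dx = r^(d-1) dr dσ` in polar coordinates. -/
abbrev surf (d : ℕ) : Measure (Sph d) := (volume : Measure (Euc d)).toSphere

/-- Lebesgue measure on the unit ball `B₁`. -/
abbrev volBall (d : ℕ) : Measure (Euc d) := volume.restrict (Metric.ball 0 1)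

instance instIsFiniteMeasureVolBall (d : ℕ) : IsFiniteMeasure (volBall d) :=
  ⟨by rw [Measure.restrict_apply_univ]; exact measure_ball_lt_top⟩

/-- `L²(∂B₁)`. -/
abbrev L2Sph (d : ℕ) : Type := Lp ℝ 2 (surf d)

/-- `L²(∂B₁; ℝ^d)`. -/
abbrev L2SphVec (d : ℕ) : Type := Lp (Euc d) 2 (surf d)

/-- The component of the vector `v` that is tangent to the sphere at `θ`. -/
def tang {d : ℕ} (v : Euc d) (θ : Sph d) : Euc d := v - inner ℝ v (θ : Euc d) • (θ : Euc d)

/-- `g` is the weak tangential gradient of `f` on `∂B₁`: integration by parts on the sphere,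
`∫ f (div_θ (φ v) - (d-1) φ v·θ) dσ = - ∫ φ g·v dσ`, against the vector fields `φ v` with `φ`
smooth and `v` constant; the tangential divergence of `φ v` at `θ` is the derivative of `φ` in the
direction of the tangential part of `v`. (The identity forces `g θ` to be tangent at `θ` for
almost every `θ`, and it determines `g`.) -/
def IsWeakGradSph {d : ℕ} (f : Sph d → ℝ) (g : Sph d → Euc d) : Prop :=
  ∀ φ : Euc d → ℝ, ContDiff ℝ ∞ φ → ∀ v : Euc d,
    ∫ θ : Sph d, f θ * (fderiv ℝ φ (θ : Euc d) (tang v θ)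
        - ((d : ℝ) - 1) * φ θ * inner ℝ v (θ : Euc d)) ∂(surf d)
      = - ∫ θ : Sph d, φ θ * inner ℝ (g θ) v ∂(surf d)

/-- `g` is the weak gradient of `f` in `B₁`. -/
def IsWeakGradBall {d : ℕ} (f : Euc d → ℝ) (g : Euc d → Euc d) : Prop :=
  ∀ φ : Euc d → ℝ, ContDiff ℝ ∞ φ → HasCompactSupport φ → tsupport φ ⊆ Metric.ball 0 1 →
    ∀ v : Euc d,
      ∫ x, f x * fderiv ℝ φ x v ∂(volBall d) = - ∫ x, φ x * inner ℝ (g x) v ∂(volBall d)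

section helpers

lemma integrable_mul_of_L2 {X : Type*} [MeasurableSpace X] {μ : Measure X} [IsFiniteMeasure μ]
    (f : Lp ℝ 2 μ) {w : X → ℝ} (hw : AEStronglyMeasurable w μ) {C : ℝ}
    (hC : ∀ x, ‖w x‖ ≤ C) : Integrable (fun x => f x * w x) μ :=
  ((Lp.memLp f).integrable (by norm_num)).mul_bdd hw (Filter.Eventually.of_forall hC)

lemma integrable_mul_inner_of_L2 {X : Type*} [MeasurableSpace X] {μ : Measure X}
    [IsFiniteMeasure μ] {d : ℕ} (g : Lp (Euc d) 2 μ) (v : Euc d) {w : X → ℝ}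
    (hw : AEStronglyMeasurable w μ) {C : ℝ} (hC : ∀ x, ‖w x‖ ≤ C) :
    Integrable (fun x => w x * inner ℝ (g x) v) μ :=
  (((Lp.memLp g).integrable (by norm_num)).inner_const v).bdd_mul hw
    (Filter.Eventually.of_forall hC)

lemma exists_bound_sph {d : ℕ} {w : Sph d → ℝ} (hw : Continuous w) : ∃ C, ∀ θ, ‖w θ‖ ≤ C := by
  obtain ⟨C, hC⟩ := isCompact_univ.exists_bound_of_continuousOn (hw.continuousOn (s := univ))
  exact ⟨C, fun θ => hC θ (mem_univ _)⟩

lemma continuous_weight {d : ℕ} {φ : Euc d → ℝ} (hφ : ContDiff ℝ ∞ φ) (v : Euc d) :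
    Continuous (fun θ : Sph d => fderiv ℝ φ (θ : Euc d) (tang v θ)
        - ((d : ℝ) - 1) * φ θ * inner ℝ v (θ : Euc d)) := by
  have h1 : Continuous (fderiv ℝ φ) := hφ.continuous_fderiv (by simp)
  have h2 : Continuous φ := hφ.continuous
  unfold tang
  fun_prop

/-- Pairs (function, vector field) in `L²` that satisfy a family of integration by parts
identities with bounded weights form a linear space. -/
lemma ibp_add {X : Type*} [MeasurableSpace X] {μ : Measure X} [IsFiniteMeasure μ] {d : ℕ}
    {a w : X → ℝ} (v : Euc d) (ha : AEStronglyMeasurable a μ) (hw : AEStronglyMeasurable w μ)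
    {A C : ℝ} (hA : ∀ x, ‖a x‖ ≤ A) (hC : ∀ x, ‖w x‖ ≤ C)
    (f₁ f₂ : Lp ℝ 2 μ) (g₁ g₂ : Lp (Euc d) 2 μ)
    (h₁ : ∫ x, f₁ x * a x ∂μ = - ∫ x, w x * inner ℝ (g₁ x) v ∂μ)
    (h₂ : ∫ x, f₂ x * a x ∂μ = - ∫ x, w x * inner ℝ (g₂ x) v ∂μ) :
    ∫ x, (f₁ + f₂ : Lp ℝ 2 μ) x * a x ∂μ
      = - ∫ x, w x * inner ℝ ((g₁ + g₂ : Lp (Euc d) 2 μ) x) v ∂μ := by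
  have e1 : (fun x => (f₁ + f₂ : Lp ℝ 2 μ) x * a x) =ᵐ[μ] fun x => f₁ x * a x + f₂ x * a x := by
    filter_upwards [Lp.coeFn_add f₁ f₂] with x hx
    rw [hx, Pi.add_apply, add_mul]
  have e2 : (fun x => w x * inner ℝ ((g₁ + g₂ : Lp (Euc d) 2 μ) x) v) =ᵐ[μ]
      fun x => w x * inner ℝ (g₁ x) v + w x * inner ℝ (g₂ x) v := by
    filter_upwards [Lp.coeFn_add g₁ g₂] with x hx
    rw [hx, Pi.add_apply, inner_add_left, mul_add]
  rw [integral_congr_ae e1, integral_congr_ae e2,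
    integral_add (integrable_mul_of_L2 f₁ ha hA) (integrable_mul_of_L2 f₂ ha hA),
    integral_add (integrable_mul_inner_of_L2 g₁ v hw hC) (integrable_mul_inner_of_L2 g₂ v hw hC),
    h₁, h₂]
  ring

lemma ibp_smul {X : Type*} [MeasurableSpace X] {μ : Measure X} {d : ℕ}
    {a w : X → ℝ} (v : Euc d) (k : ℝ) (f : Lp ℝ 2 μ) (g : Lp (Euc d) 2 μ)
    (h : ∫ x, f x * a x ∂μ = - ∫ x, w x * inner ℝ (g x) v ∂μ) :
    ∫ x, (k • f : Lp ℝ 2 μ) x * a x ∂μ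
      = - ∫ x, w x * inner ℝ ((k • g : Lp (Euc d) 2 μ) x) v ∂μ := by
  have e1 : (fun x => (k • f : Lp ℝ 2 μ) x * a x) =ᵐ[μ] fun x => k * (f x * a x) := by
    filter_upwards [Lp.coeFn_smul k f] with x hx
    rw [hx, Pi.smul_apply, smul_eq_mul, mul_assoc]
  have e2 : (fun x => w x * inner ℝ ((k • g : Lp (Euc d) 2 μ) x) v) =ᵐ[μ]
      fun x => k * (w x * inner ℝ (g x) v) := by
    filter_upwards [Lp.coeFn_smul k g] with x hx
    rw [hx, Pi.smul_apply, real_inner_smul_left]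
    ring
  rw [integral_congr_ae e1, integral_congr_ae e2, integral_const_mul, integral_const_mul, h]
  ring

lemma ibp_zero {X : Type*} [MeasurableSpace X] {μ : Measure X} {d : ℕ}
    {a w : X → ℝ} (v : Euc d) :
    ∫ x, (0 : Lp ℝ 2 μ) x * a x ∂μ = - ∫ x, w x * inner ℝ ((0 : Lp (Euc d) 2 μ) x) v ∂μ := by
  have e1 : (fun x => (0 : Lp ℝ 2 μ) x * a x) =ᵐ[μ] fun _ => 0 := by
    filter_upwards [Lp.coeFn_zero ℝ 2 μ] with x hx
    rw [hx]; simp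
  have e2 : (fun x => w x * inner ℝ ((0 : Lp (Euc d) 2 μ) x) v) =ᵐ[μ] fun _ => 0 := by
    filter_upwards [Lp.coeFn_zero (Euc d) 2 μ] with x hx
    rw [hx]; simp
  rw [integral_congr_ae e1, integral_congr_ae e2]
  simp

end helpers

/-- The Sobolev space `H¹(∂B₁)`. Its elements are the pairs `(f, ∇_θ f)` of a function in `L²` and
its weak tangential gradient in `L²`; the norm is `(‖f‖² + ‖∇_θ f‖²)^(1/2)`. -/
def H1Sph (d : ℕ) : Submodule ℝ (WithLp 2 (L2Sph d × L2SphVec d)) where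
  carrier := {p | IsWeakGradSph p.fst p.snd}
  zero_mem' := fun _ _ v => ibp_zero v
  add_mem' := by
    intro p q hp hq φ hφ v
    obtain ⟨A, hA⟩ := exists_bound_sph (continuous_weight hφ v)
    have hc : Continuous (fun θ : Sph d => φ θ) := hφ.continuous.comp continuous_subtype_val
    obtain ⟨C, hC⟩ := exists_bound_sph hc
    exact ibp_add v (continuous_weight hφ v).aestronglyMeasurable hc.aestronglyMeasurable hA hC
      p.fst q.fst p.snd q.snd (hp φ hφ v) (hq φ hφ v)
  smul_mem' := fun k p hp φ hφ v => ibp_smul v k p.fst p.snd (hp φ hφ v)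

/-- The Sobolev space `H¹(B₁)`. Its elements are the pairs `(f, ∇f)` of a function in `L²` and its
weak gradient in `L²`; the norm is `(‖f‖² + ‖∇f‖²)^(1/2)`. -/
def H1Ball (d : ℕ) : Submodule ℝ (WithLp 2 (Lp ℝ 2 (volBall d) × Lp (Euc d) 2 (volBall d))) where
  carrier := {p | IsWeakGradBall p.fst p.snd}
  zero_mem' := fun _ _ _ _ v => ibp_zero v
  add_mem' := by
    intro p q hp hq φ hφ hs ht v
    have h1 : Continuous (fun x => fderiv ℝ φ x v) :=
      (hφ.continuous_fderiv (by simp)).clm_apply continuous_const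
    obtain ⟨A, hA⟩ := h1.bounded_above_of_compact_support (hs.fderiv_apply (𝕜 := ℝ) v)
    obtain ⟨C, hC⟩ := hφ.continuous.bounded_above_of_compact_support hs
    exact ibp_add v h1.aestronglyMeasurable hφ.continuous.aestronglyMeasurable hA hC
      p.fst q.fst p.snd q.snd (hp φ hφ hs ht v) (hq φ hφ hs ht v)
  smul_mem' := fun k p hp φ hφ hs ht v => ibp_smul v k p.fst p.snd (hp φ hφ hs ht v)

/-- The inclusion of `H¹(∂B₁)` in `L²(∂B₁)`. -/
def toL2 {d : ℕ} : H1Sph d →L[ℝ] L2Sph d :=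
  (ContinuousLinearMap.fst ℝ (L2Sph d) (L2SphVec d)).comp
    ((WithLp.prodContinuousLinearEquiv 2 ℝ (L2Sph d) (L2SphVec d)).toContinuousLinearMap.comp
      (H1Sph d).subtypeL)

/-- The tangential gradient of an element of `H¹(∂B₁)`. -/
def gradSph {d : ℕ} (u : H1Sph d) : L2SphVec d :=
  (u : WithLp 2 (L2Sph d × L2SphVec d)).snd

/-- An element of `H¹(B₁)` as a function. -/
def ballFun {d : ℕ} (h : H1Ball d) : Lp ℝ 2 (volBall d) :=
  (h : WithLp 2 (Lp ℝ 2 (volBall d) × Lp (Euc d) 2 (volBall d))).fst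

/-- The gradient of an element of `H¹(B₁)`. -/
def gradBall {d : ℕ} (h : H1Ball d) : Lp (Euc d) 2 (volBall d) :=
  (h : WithLp 2 (Lp ℝ 2 (volBall d) × Lp (Euc d) 2 (volBall d))).snd

/-- The Sobolev space `H²(∂B₁)`: functions `u` in `H¹(∂B₁)` such that each of the `d` components
of the tangential gradient of `u` is in `H¹(∂B₁)`. Its elements are the pairs formed by `u` and the
tuple of these components; the norm is `(‖u‖_{H¹}² + ∑ᵢ ‖(∇_θ u)ᵢ‖_{H¹}²)^(1/2)`. -/
def H2Sph (d : ℕ) : Submodule ℝ (WithLp 2 (H1Sph d × PiLp 2 (fun _ : Fin d => H1Sph d))) where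
  carrier := {p | ∀ i, ∀ᵐ θ ∂(surf d), toL2 (p.snd i) θ = (gradSph p.fst θ) i}
  zero_mem' := by
    intro i
    have e1 : toL2 ((0 : WithLp 2 (H1Sph d × PiLp 2 (fun _ : Fin d => H1Sph d))).snd i)
        = (0 : L2Sph d) := by
      simp
    have e2 : gradSph (0 : WithLp 2 (H1Sph d × PiLp 2 (fun _ : Fin d => H1Sph d))).fst
        = (0 : L2SphVec d) := rfl
    filter_upwards [Lp.coeFn_zero ℝ 2 (surf d), Lp.coeFn_zero (Euc d) 2 (surf d)] with θ h1 h2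
    rw [e1, e2, h1, h2]
    simp
  add_mem' := by
    intro p q hp hq i
    have e1 : toL2 ((p + q).snd i) = toL2 (p.snd i) + toL2 (q.snd i) := by
      simp
    have e2 : gradSph (p + q).fst = gradSph p.fst + gradSph q.fst := rfl
    filter_upwards [hp i, hq i,
      Lp.coeFn_add (toL2 (p.snd i)) (toL2 (q.snd i)),
      Lp.coeFn_add (gradSph p.fst) (gradSph q.fst)] with θ h1 h2 h3 h4
    rw [e1, e2, h3, h4, Pi.add_apply, Pi.add_apply, h1, h2]
    simp
  smul_mem' := by
    intro k p hp i
    have e1 : toL2 ((k • p).snd i) = k • toL2 (p.snd i) := by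
      simp
    have e2 : gradSph (k • p).fst = k • gradSph p.fst := rfl
    filter_upwards [hp i, Lp.coeFn_smul k (toL2 (p.snd i)),
      Lp.coeFn_smul k (gradSph p.fst)] with θ h1 h3 h4
    rw [e1, e2, h3, h4, Pi.smul_apply, Pi.smul_apply, h1]
    simp

/-- The inclusion of `H²(∂B₁)` in `H¹(∂B₁)`. -/
def toH1 {d : ℕ} (u : H2Sph d) : H1Sph d :=
  (u : WithLp 2 (H1Sph d × PiLp 2 (fun _ : Fin d => H1Sph d))).fst

/-- `c` is the trace of `h` on `∂B₁`, that is `h(1,·) = c`: the Gauss-Green formula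
`∫_{B₁} (h ∂_v φ + φ ∂_v h) dx = ∫_{∂B₁} c φ v·θ dσ` holds for all smooth `φ` on `ℝ^d` and all
vectors `v`. -/
def HasTrace {d : ℕ} (h : H1Ball d) (c : L2Sph d) : Prop :=
  ∀ φ : Euc d → ℝ, ContDiff ℝ ∞ φ → ∀ v : Euc d,
    ∫ x, (ballFun h x * fderiv ℝ φ x v + φ x * inner ℝ (gradBall h x) v) ∂(volBall d)
      = ∫ θ : Sph d, c θ * φ θ * inner ℝ v (θ : Euc d) ∂(surf d)

/-- `h(r,θ) = r^α u(r,θ)` in polar coordinates, for almost every `r ∈ (0,1)` and `θ ∈ ∂B₁`. -/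
def EqPolar {d : ℕ} (h : H1Ball d) (α : ℝ) (u : ℝ → H1Sph d) : Prop :=
  ∀ᵐ r ∂(volume.restrict (Ioo (0 : ℝ) 1)), ∀ᵐ θ : Sph d ∂(surf d),
    ballFun h (r • (θ : Euc d)) = r ^ α * toL2 (u r) θ

/-- `u = u(r,θ)` belongs to `H¹([0,1] × ∂B₁)`, with weak radial derivative `u' = ∂_r u`. The space
is written as `L²((0,1); H¹(∂B₁)) ∩ H¹((0,1); L²(∂B₁))`. -/
structure MemH1Cylinder {d : ℕ} (u : ℝ → H1Sph d) (u' : ℝ → L2Sph d) : Prop where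
  memLp : MemLp u 2 (volume.restrict (Ioo (0 : ℝ) 1))
  memLp_deriv : MemLp u' 2 (volume.restrict (Ioo (0 : ℝ) 1))
  weak_deriv : ∀ η : ℝ → ℝ, ContDiff ℝ ∞ η → HasCompactSupport η → tsupport η ⊆ Ioo 0 1 →
    ∫ r in Ioo (0 : ℝ) 1, deriv η r • toL2 (u r) = - ∫ r in Ioo (0 : ℝ) 1, η r • u' r

/-- `𝓕 : H¹(∂B₁) → ℝ` is differentiable at the points of `H²(∂B₁)`, with gradient
`∇𝓕 : H²(∂B₁) → L²(∂B₁)`: for `u` in `H²` and `v` in `H¹`,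
`𝓕(u + v) = 𝓕(u) + ∫ v ∇𝓕(u) dσ + o(‖v‖_{H¹})`. -/
def HasL2Gradient {d : ℕ} (F : H1Sph d → ℝ) (gradF : H2Sph d → L2Sph d) : Prop :=
  ∀ u : H2Sph d, HasFDerivAt F ((innerSL ℝ (gradF u)).comp toL2) (toH1 u)

/-- The slicing inequality between `𝓖` and `𝓕`, with equality for `u` constant in `r`. -/
structure Slicing {d : ℕ} (α CSL : ℝ) (G : H1Ball d → ℝ) (F : H1Sph d → ℝ) : Prop where
  le : ∀ (u : ℝ → H1Sph d) (u' : ℝ → L2Sph d), MemH1Cylinder u u' →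
    IntegrableOn (fun r => F (u r) * r ^ (2 * α + d - 3)) (Ioo (0 : ℝ) 1) →
    ∀ h : H1Ball d, EqPolar h α u →
      G h ≤ (∫ r in Ioo (0 : ℝ) 1, F (u r) * r ^ (2 * α + d - 3))
        + CSL * ∫ r in Ioo (0 : ℝ) 1, ‖u' r‖ ^ 2 * r ^ (2 * α + d - 1)
  eq_of_const : ∀ (c : H1Sph d) (h : H1Ball d), EqPolar h α (fun _ => c) →
    G h = ∫ r in Ioo (0 : ℝ) 1, F c * r ^ (2 * α + d - 3)

/-- `S` is a compact set in `H²(∂B₁)` of critical points of `𝓕`, and `𝓕` is constant on `S` with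
value `FS = 𝓕(S)`. -/
structure IsCriticalSet {d : ℕ} (F : H1Sph d → ℝ) (gradF : H2Sph d → L2Sph d)
    (S : Set (H2Sph d)) (FS : ℝ) : Prop where
  isCompact : IsCompact S
  nonempty : S.Nonempty
  critical : ∀ Q ∈ S, gradF Q = 0
  const : ∀ Q ∈ S, F (toH1 Q) = FS

/-- First type of flow: `ψ ∈ L²(0,T; H²(∂B₁))`, with `ψ' ∈ L²(∂B₁)`. Here
`dF t = ψ'(t) · ∇𝓕(ψ(t))` is a scalar product in `L²(∂B₁)`. -/
def FlowPairingL2 {d : ℕ} (gradF : H2Sph d → L2Sph d) (T : ℝ) (ψ : ℝ → H1Sph d)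
    (ψ' : ℝ → L2Sph d) (dF : ℝ → ℝ) : Prop :=
  ∃ ψ₂ : ℝ → H2Sph d, MemLp ψ₂ 2 (volume.restrict (Ioo 0 T)) ∧
    ∀ᵐ t ∂(volume.restrict (Ioo 0 T)),
      toH1 (ψ₂ t) = ψ t ∧ dF t = inner ℝ (ψ' t) (gradF (ψ₂ t))

/-- Second type of flow: `ψ` and `ψ'` are in `L²(0,T; H¹(∂B₁))`, and `𝓕` is differentiable along
`ψ`. Here `dF t = ψ'(t) · ∇𝓕(ψ(t))` is the pairing of `H¹(∂B₁)` with its dual. -/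
def FlowPairingH1 {d : ℕ} (F : H1Sph d → ℝ) (T : ℝ) (ψ : ℝ → H1Sph d)
    (ψ' : ℝ → L2Sph d) (dF : ℝ → ℝ) : Prop :=
  (∀ t ∈ Ioo 0 T, DifferentiableAt ℝ F (ψ t)) ∧
  ∃ ψ'₁ : ℝ → H1Sph d, MemLp ψ'₁ 2 (volume.restrict (Ioo 0 T)) ∧
    ∀ᵐ t ∂(volume.restrict (Ioo 0 T)),
      toL2 (ψ'₁ t) = ψ' t ∧ dF t = fderiv ℝ F (ψ t) (ψ'₁ t)

/-- `ψ`, on `[0,T]`, is a flow with time derivative `ψ'`, along which the energy `𝓕(ψ(t))` is weakly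
differentiable with integrable derivative `dF t = ψ'(t) · ∇𝓕(ψ(t))`. -/
structure IsFlow {d : ℕ} (F : H1Sph d → ℝ) (gradF : H2Sph d → L2Sph d) (T : ℝ)
    (ψ : ℝ → H1Sph d) (ψ' : ℝ → L2Sph d) (dF : ℝ → ℝ) : Prop where
  memLp : MemLp ψ 2 (volume.restrict (Ioo 0 T))
  memLp_deriv : MemLp ψ' 2 (volume.restrict (Ioo 0 T))
  deriv : ∀ s t, 0 ≤ s → s ≤ t → t ≤ T →
    toL2 (ψ t) - toL2 (ψ s) = ∫ τ in Ioo s t, ψ' τ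
  pairing : FlowPairingL2 gradF T ψ ψ' dF ∨ FlowPairingH1 F T ψ ψ' dF
  integrable_dF : IntegrableOn dF (Ioo 0 T)
  energy_deriv : ∀ s t, 0 ≤ s → s ≤ t → t ≤ T → F (ψ t) - F (ψ s) = ∫ τ in Ioo s t, dF τ

/-- The energy dissipation inequality along the flow. -/
def EnergyDissipation {d : ℕ} (CED p T : ℝ) (ψ' : ℝ → L2Sph d) (dF : ℝ → ℝ) : Prop :=
  ∀ᵐ t ∂(volume.restrict (Ioo 0 T)), CED * min (‖ψ' t‖ ^ 2) (‖ψ' t‖ ^ p) ≤ - dF t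

/-- The Łojasiewicz inequality along the flow. It is required at the times at which the power of
`𝓕(ψ(t)) - 𝓕(S)` makes sense; at the other times it asks nothing. -/
def Lojasiewicz {d : ℕ} (CLS β T : ℝ) (F : H1Sph d → ℝ) (FS : ℝ) (ψ : ℝ → H1Sph d)
    (dF : ℝ → ℝ) : Prop :=
  ∀ᵐ t ∂(volume.restrict (Ioo 0 T)),
    FS ≤ F (ψ t) → CLS * (F (ψ t) - FS) ^ (1 + β) ≤ - dF t

end LogEpi

end

open LogEpi

/-! The competitor is the flow itself, run in logarithmic time t = -κ ln r and frozen at a time T.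
Put a = 2α + d - 2, x = 𝓕(c) - 𝓕(S), D = -dF. If x ≤ 0, the homogeneous extension already works. If
0 < x ≤ 1, let T be a time up to which the excess stays at least x/2 and at which either it equals
x/2 or the flow ends (`exists_stopping_time`).

Slicing bounds 𝓖(h) by a potential term and a kinetic term. Integrating the potential term by parts
against r^a/a turns it into 𝓕(c)/a - I/a, where I = ∫ κ r^(a-1) D dr over the radii at which the
flow is still running (`integral_stopped_energy`). The kinetic term is the integral of C_SL κ²
r^(a-1) ‖ψ'‖² over the same radii, so it costs at most half of I/a as soon as 2a C_SL κ ‖ψ'‖² ≤ D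
(`integral_stopped_kinetic_le`).

This dictates κ. Before T the Łojasiewicz inequality gives D ≥ C_ED q, with q proportional to
x^(1+β), and dissipation then gives ‖ψ'‖² ≤ (D/C_ED)(1 + q^(-(1-2/p))) (`sq_le_of_dissipation`).
Hence κ = k q^(1-2/p) with k small is admissible. For this κ, either the flow runs for time κ, so
that I is at least of order κ q ~ q^(2-2/p) ~ x^(1+γ), or it loses x/2 while r > 1/e, so that I is
at least of order x ≥ x^(1+γ) (`le_integral_stopped_dissipation`). Half of I/a is the asserted gain.

The analytic burden is that h lies in H¹(B₁) with trace c (`exists_h1Ball_of_polar`). Both facts are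
contained in the Gauss-Green formula against arbitrary smooth test functions, which in polar
coordinates splits into integration by parts on each sphere and in r. The latter, like the one for
the energy, is an instance of `integral_bilin_primitive`. -/

namespace LogEpi

/-! ### Integration by parts for primitives. -/

section calculus

variable {E F G : Type*} [NormedAddCommGroup E] [NormedSpace ℝ E] [CompleteSpace E]
  [NormedAddCommGroup F] [NormedSpace ℝ F] [CompleteSpace F]
  [NormedAddCommGroup G] [NormedSpace ℝ G] [CompleteSpace G]

/-- Integration by parts on `(0,1)` for a bilinear pairing of two primitives of integrable
functions, the second of which vanishes at `0`. -/
theorem integral_bilin_primitive (L : E →L[ℝ] F →L[ℝ] G) {A A' : ℝ → E} {B B' : ℝ → F}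
    (hA' : IntegrableOn A' (Ioo 0 1)) (hB' : IntegrableOn B' (Ioo 0 1))
    (hA : ∀ r ∈ Ioo (0 : ℝ) 1, A 1 - A r = ∫ s in Ioo r 1, A' s)
    (hB : ∀ r ∈ Ioc (0 : ℝ) 1, B r = ∫ s in Ioo 0 r, B' s) :
    IntegrableOn (fun r => L (A r) (B' r)) (Ioo 0 1) ∧
    IntegrableOn (fun r => L (A' r) (B r)) (Ioo 0 1) ∧
    (∫ r in Ioo (0 : ℝ) 1, L (A r) (B' r)) + (∫ r in Ioo (0 : ℝ) 1, L (A' r) (B r))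
      = L (A 1) (B 1) := by
  unfold IntegrableOn at *
  set μ : Measure ℝ := volume.restrict (Ioo (0 : ℝ) 1) with hμ
  -- The proof is Fubini for this kernel on the triangle r < s: integrating in s gives L (A 1 - A r)
  -- (B' r), integrating in r gives L (A' s) (B s). No derivative of A or B is needed.
  have hk0 : Integrable (fun q : ℝ × ℝ => L (A' q.2) (B' q.1)) (μ.prod μ) := by
    have hm : AEStronglyMeasurable (fun q : ℝ × ℝ => L (A' q.2) (B' q.1)) (μ.prod μ) :=
      L.aestronglyMeasurable_comp₂ hA'.aestronglyMeasurable.comp_snd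
        hB'.aestronglyMeasurable.comp_fst
    have hb : Integrable (fun q : ℝ × ℝ => ‖L‖ * (‖B' q.1‖ * ‖A' q.2‖)) (μ.prod μ) :=
      (hB'.norm.mul_prod hA'.norm).const_mul _
    refine hb.mono' hm (Filter.Eventually.of_forall fun q => ?_)
    calc ‖L (A' q.2) (B' q.1)‖ ≤ ‖L‖ * ‖A' q.2‖ * ‖B' q.1‖ := L.le_opNorm₂ _ _
      _ = _ := by ring
  have hlt : MeasurableSet {q : ℝ × ℝ | q.1 < q.2} :=
    measurableSet_lt measurable_fst measurable_snd
  have hk := hk0.indicator hlt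
  set k : ℝ × ℝ → G := {q : ℝ × ℝ | q.1 < q.2}.indicator fun q => L (A' q.2) (B' q.1) with hkdef
  have hi : Integrable (fun r => ∫ s, k (r, s) ∂μ) μ := hk.integral_prod_left
  have hj : Integrable (fun s => ∫ r, k (r, s) ∂μ) μ := hk.integral_prod_right
  have h1 : ∀ r ∈ Ioo (0 : ℝ) 1, ∫ s, k (r, s) ∂μ = L (A 1) (B' r) - L (A r) (B' r) := by
    intro r hr
    have : (fun s => k (r, s)) = (Ioi r).indicator fun s => L.flip (B' r) (A' s) := by
      ext s; by_cases h : r < s <;> simp [hkdef, indicator, h]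
    rw [this, integral_indicator measurableSet_Ioi, hμ, Measure.restrict_restrict measurableSet_Ioi]
    have hs : Ioi r ∩ Ioo 0 1 = Ioo r 1 := by
      ext s; simp only [mem_inter_iff, mem_Ioi, mem_Ioo]; constructor
      · rintro ⟨a, b, c⟩; exact ⟨a, c⟩
      · rintro ⟨a, c⟩; exact ⟨a, hr.1.trans a, c⟩
    have hAi : IntegrableOn A' (Ioo r 1) :=
      IntegrableOn.mono_set hA' (Ioo_subset_Ioo_left hr.1.le)
    rw [hs, ContinuousLinearMap.integral_comp_comm _ hAi, ← hA r hr]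
    simp
  have h2 : ∀ s ∈ Ioo (0 : ℝ) 1, ∫ r, k (r, s) ∂μ = L (A' s) (B s) := by
    intro r hr
    have : (fun s => k (s, r)) = (Iio r).indicator fun s => L (A' r) (B' s) := by
      ext s; by_cases h : s < r <;> simp [hkdef, indicator, h]
    rw [this, integral_indicator measurableSet_Iio, hμ, Measure.restrict_restrict measurableSet_Iio]
    have hs : Iio r ∩ Ioo 0 1 = Ioo 0 r := by
      ext s; simp only [mem_inter_iff, mem_Iio, mem_Ioo]; constructor
      · rintro ⟨a, b, c⟩; exact ⟨b, a⟩
      · rintro ⟨a, c⟩; exact ⟨c, a, c.trans hr.2⟩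
    have hBi : IntegrableOn B' (Ioo 0 r) :=
      IntegrableOn.mono_set hB' (Ioo_subset_Ioo_right hr.2.le)
    rw [hs, ContinuousLinearMap.integral_comp_comm _ hBi, ← hB r ⟨hr.1, hr.2.le⟩]
  have hc : Integrable (fun r => L (A 1) (B' r)) μ := (L (A 1)).integrable_comp hB'
  have e1 : (fun r => L (A r) (B' r)) =ᵐ[μ] fun r => L (A 1) (B' r) - ∫ s, k (r, s) ∂μ := by
    filter_upwards [ae_restrict_mem measurableSet_Ioo] with r hr
    rw [h1 r hr]; abel
  have e2 : (fun r => L (A' r) (B r)) =ᵐ[μ] fun r => ∫ s, k (s, r) ∂μ := by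
    filter_upwards [ae_restrict_mem measurableSet_Ioo] with r hr
    rw [h2 r hr]
  refine ⟨(hc.sub hi).congr e1.symm, hj.congr e2.symm, ?_⟩
  rw [integral_congr_ae e1, integral_congr_ae e2, integral_sub hc hi,
    integral_integral_swap (f := fun r s => k (r, s)) hk, ContinuousLinearMap.integral_comp_comm _ hB',
    hB 1 ⟨one_pos, le_rfl⟩]
  abel

end calculus

/-! ### Jointly measurable representatives of L²-valued maps. -/

section uncurry

variable {X Y E : Type*} [MeasurableSpace X] [MeasurableSpace Y] {μ : Measure X} {ν : Measure Y}
  [IsFiniteMeasure ν] [NormedAddCommGroup E]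

/-- Tonelli. This makes uncurrying an isometry, both for the final square integrability and for the
passage to limits. -/
theorem eLpNorm_prod_of_sections {f : X → Lp E 2 ν} {g : X × Y → E}
    (hg : AEStronglyMeasurable g (μ.prod ν)) (h : ∀ᵐ x ∂μ, (fun y => g (x, y)) =ᵐ[ν] f x) :
    eLpNorm g 2 (μ.prod ν) = eLpNorm f 2 μ := by
  rw [eLpNorm_eq_lintegral_rpow_enorm_toReal (by norm_num) (by norm_num),
    eLpNorm_eq_lintegral_rpow_enorm_toReal (by norm_num) (by norm_num),
    lintegral_prod _ (hg.enorm.pow_const _)]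
  congr 1
  refine lintegral_congr_ae ?_
  filter_upwards [h] with x hx
  have h1 : ‖f x‖ₑ = eLpNorm (fun y => g (x, y)) 2 ν := by
    rw [Lp.enorm_def]; exact (eLpNorm_congr_ae hx).symm
  rw [h1, eLpNorm_eq_lintegral_rpow_enorm_toReal (by norm_num) (by norm_num), ← ENNReal.rpow_mul]
  simp

/-- An element of `L²(X; L²(Y))` has a representative that is jointly measurable. -/
theorem exists_memLp_uncurry [IsFiniteMeasure μ] [NormedSpace ℝ E] [CompleteSpace E] {f : X → Lp E 2 ν}
    (hf : MemLp f 2 μ) :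
    ∃ g : X × Y → E, MemLp g 2 (μ.prod ν) ∧ ∀ᵐ x ∂μ, (fun y => g (x, y)) =ᵐ[ν] f x := by
  suffices H : ∃ g : X × Y → E, AEStronglyMeasurable g (μ.prod ν) ∧
      ∀ᵐ x ∂μ, (fun y => g (x, y)) =ᵐ[ν] f x by
    obtain ⟨g, hg, hs⟩ := H
    exact ⟨g, ⟨hg, by rw [eLpNorm_prod_of_sections hg hs]; exact hf.2⟩, hs⟩
  refine MemLp.induction (p := 2) (by norm_num) (fun f : X → Lp E 2 ν =>
    ∃ g : X × Y → E, AEStronglyMeasurable g (μ.prod ν) ∧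
      ∀ᵐ x ∂μ, (fun y => g (x, y)) =ᵐ[ν] f x) ?_ ?_ ?_ ?_ hf
  · intro c s hs _
    refine ⟨(Prod.fst ⁻¹' s).indicator fun q => c q.2,
      (Lp.aestronglyMeasurable c).comp_snd.indicator (measurable_fst hs),
      Filter.Eventually.of_forall fun x => ?_⟩
    by_cases hx : x ∈ s
    · simp [indicator, hx]
    · simp only [indicator, mem_preimage, hx, if_false]
      exact (Lp.coeFn_zero E 2 ν).symm
  · rintro f₁ f₂ - - - ⟨g₁, m₁, h₁⟩ ⟨g₂, m₂, h₂⟩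
    refine ⟨g₁ + g₂, m₁.add m₂, ?_⟩
    filter_upwards [h₁, h₂] with x hx₁ hx₂
    filter_upwards [hx₁, hx₂, Lp.coeFn_add (f₁ x) (f₂ x)] with y hy₁ hy₂ hy
    simp only [Pi.add_apply] at *
    rw [hy, hy₁, hy₂]
  -- By the isometry the representatives form a Cauchy sequence, and their limit G is the candidate
  -- for f. It is identified on almost every section by extracting subsequences three times: a.e.
  -- convergence on the product, then in x, then in y for fixed x.
  · refine IsSeqClosed.isClosed fun u f hu hlim => ?_
    choose g hgm hgs using hu
    have hmem : ∀ n, MemLp (g n) 2 (μ.prod ν) := fun n =>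
      ⟨hgm n, by rw [eLpNorm_prod_of_sections (hgm n) (hgs n)]; exact (Lp.memLp (u n)).2⟩
    have hiso : ∀ n m, dist ((hmem n).toLp) ((hmem m).toLp) = dist (u n) (u m) := by
      intro n m
      rw [dist_eq_norm, dist_eq_norm, ← MemLp.toLp_sub, Lp.norm_toLp, Lp.norm_def]
      congr 1
      refine eLpNorm_prod_of_sections (f := ⇑(u n - u m)) ((hgm n).sub (hgm m)) ?_
      filter_upwards [hgs n, hgs m, Lp.coeFn_sub (u n) (u m)] with x h1 h2 h3
      rw [h3]
      filter_upwards [h1, h2, Lp.coeFn_sub (u n x) (u m x)] with y h4 h5 h6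
      simp only [Pi.sub_apply] at *
      rw [h6, h4, h5]
    have hC : CauchySeq fun n => (hmem n).toLp := by
      rw [Metric.cauchySeq_iff]
      intro ε hε
      obtain ⟨N, hN⟩ := Metric.cauchySeq_iff.1 hlim.cauchySeq ε hε
      exact ⟨N, fun m hm n hn => by rw [hiso]; exact hN m hm n hn⟩
    obtain ⟨G, hG⟩ := cauchySeq_tendsto_of_complete hC
    refine ⟨G, Lp.aestronglyMeasurable G, ?_⟩
    obtain ⟨k₁, hk₁, ha₁⟩ := (tendstoInMeasure_of_tendsto_Lp hG).exists_seq_tendsto_ae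
    obtain ⟨k₂, hk₂, ha₂⟩ := (tendstoInMeasure_of_tendsto_Lp
      (hlim.comp hk₁.tendsto_atTop)).exists_seq_tendsto_ae
    have hg' : ∀ᵐ x ∂μ, ∀ᵐ y ∂ν, ∀ n,
        ((hmem n).toLp : X × Y → E) (x, y) = g n (x, y) :=
      Measure.ae_ae_of_ae_prod (ae_all_iff.2 fun n => (hmem n).coeFn_toLp)
    filter_upwards [Measure.ae_ae_of_ae_prod ha₁, ha₂, hg', ae_all_iff.2 hgs] with x h1 h2 h3 h4
    obtain ⟨k₃, hk₃, h5⟩ := (tendstoInMeasure_of_tendsto_Lp h2).exists_seq_tendsto_ae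
    filter_upwards [h1, h3, ae_all_iff.2 h4, h5] with y y1 y3 y4 y5
    refine tendsto_nhds_unique (y1.comp (hk₂.comp hk₃).tendsto_atTop) (y5.congr fun n => ?_)
    simp only [Function.comp_apply, y3, y4]
  · rintro f₁ f₂ h - ⟨g, m, hg⟩
    refine ⟨g, m, ?_⟩
    filter_upwards [h, hg] with x h1 h2
    rwa [← h1]

end uncurry

/-! ### Polar coordinates on the unit ball. -/

section polar

/-- The radial part `r^(d-1) dr` of Lebesgue measure on the unit ball. -/
noncomputable abbrev radial (d : ℕ) : Measure ℝ :=
  (volume.restrict (Ioo (0 : ℝ) 1)).withDensity fun r => ENNReal.ofReal (r ^ (d - 1))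

instance instIsFiniteMeasureRadial (d : ℕ) : IsFiniteMeasure (radial d) := by
  refine isFiniteMeasure_withDensity_ofReal ?_
  have h : IntegrableOn (fun r : ℝ => r ^ (d - 1)) (Icc 0 1) :=
    (continuous_pow (d - 1)).continuousOn.integrableOn_compact isCompact_Icc
  exact (h.mono_set Ioo_subset_Icc_self).2

/-- The density r^(d-1) is positive on (0,1), so the null sets are the same. -/
theorem radial_ae_iff {d : ℕ} {P : ℝ → Prop} :
    (∀ᵐ r ∂(radial d), P r) ↔ ∀ᵐ r ∂(volume.restrict (Ioo (0 : ℝ) 1)), P r := by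
  rw [ae_withDensity_iff (by fun_prop)]
  refine ⟨fun h => ?_, fun h => h.mono fun r hr _ => hr⟩
  filter_upwards [h, ae_restrict_mem measurableSet_Ioo] with r hr hmem
  exact hr (by simpa using pow_pos hmem.1 _)

theorem integral_radial {d : ℕ} (f : ℝ → ℝ) :
    ∫ r, f r ∂(radial d) = ∫ r in Ioo (0 : ℝ) 1, r ^ (d - 1) * f r := by
  rw [radial, integral_withDensity_eq_integral_toReal_smul (by fun_prop) (by simp)]
  refine setIntegral_congr_fun measurableSet_Ioo fun r hr => ?_
  simp [ENNReal.toReal_ofReal (pow_nonneg hr.1.le _)]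

theorem measurePreserving_val_volumeIoiPow (n : ℕ) :
    MeasurePreserving (Subtype.val : Ioi (0 : ℝ) → ℝ) (Measure.volumeIoiPow n)
      ((volume.restrict (Ioi (0 : ℝ))).withDensity fun r => ENNReal.ofReal (r ^ n)) := by
  refine ⟨measurable_subtype_coe, ?_⟩
  ext s hs
  rw [Measure.map_apply measurable_subtype_coe hs, Measure.volumeIoiPow,
    withDensity_apply _ (measurable_subtype_coe hs), withDensity_apply _ hs,
    ← (measurePreserving_subtype_coe (μa := (volume : Measure ℝ))
      measurableSet_Ioi).setLIntegral_comp_preimage hs (by fun_prop)]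

/-- Polar coordinates on the punctured unit ball preserve the measure. -/
theorem exists_polar {d : ℕ} (hd : 1 ≤ d) :
    ∃ M : Euc d → ℝ × Sph d, MeasurePreserving M (volBall d) ((radial d).prod (surf d)) ∧
      (∀ x, (M x).1 = ‖x‖) ∧ (∀ x, (M x).1 • ((M x).2 : Euc d) = x) := by
  classical
  have : Nonempty (Fin d) := ⟨⟨0, hd⟩⟩
  obtain ⟨θ₀, hθ₀⟩ : ∃ v : Euc d, ‖v‖ = 1 := ⟨EuclideanSpace.single ⟨0, hd⟩ 1, by simp⟩
  -- The direction at the origin is arbitrary; it makes the polar map total on the ball, and the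
  -- origin is a null set.
  let w : Euc d → Euc d := fun x => if x = 0 then θ₀ else ‖x‖⁻¹ • x
  have hw : ∀ x, w x ∈ Metric.sphere (0 : Euc d) 1 := by
    intro x
    by_cases hx : x = 0
    · simp [w, hx, hθ₀]
    · simp [w, hx, norm_smul]
  have hwm : Measurable w :=
    Measurable.ite (measurableSet_singleton 0) measurable_const (by fun_prop)
  let M : Euc d → ℝ × Sph d := fun x => (‖x‖, ⟨w x, hw x⟩)
  have hM : Measurable M := measurable_norm.prodMk (hwm.subtype_mk)
  refine ⟨M, ?_, fun x => rfl, fun x => ?_⟩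
  swap
  · by_cases hx : x = 0
    · simp [M, hx]
    · simp [M, w, hx, smul_smul]
  set ρ₀ : Measure ℝ := (volume.restrict (Ioi (0 : ℝ))).withDensity
    fun r => ENNReal.ofReal (r ^ (d - 1)) with hρ₀
  have h1 := Measure.measurePreserving_homeomorphUnitSphereProd (volume : Measure (Euc d))
  rw [finrank_euclideanSpace_fin] at h1
  have hfull : MeasurePreserving M (volume : Measure (Euc d)) (ρ₀.prod (surf d)) := by
    have h2 := (Measure.measurePreserving_swap.comp
      ((MeasurePreserving.id (surf d)).prod (measurePreserving_val_volumeIoiPow (d - 1)))).comp h1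
    have h3 := measurePreserving_subtype_coe (μa := (volume : Measure (Euc d)))
      (measurableSet_singleton (0 : Euc d)).compl
    have h4 : (volume : Measure (Euc d)).restrict {0}ᶜ = volume :=
      Measure.restrict_eq_self_of_ae_mem
        (compl_mem_ae_iff.2 (measure_singleton (μ := (volume : Measure (Euc d))) 0))
    rw [h4] at h3
    refine ⟨hM, ?_⟩
    rw [← h3.map_eq, Measure.map_map hM measurable_subtype_coe]
    convert h2.map_eq using 2
    ext x
    · simp [M]
    · have : (x : Euc d) ≠ 0 := x.2
      simp [M, w, this, homeomorphUnitSphereProd, homeomorphSphereProd]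
  have hres := hfull.restrict_preimage
    ((measurableSet_Iio (a := (1 : ℝ))).prod (MeasurableSet.univ (α := Sph d)))
  have e1 : M ⁻¹' (Iio 1 ×ˢ univ) = Metric.ball 0 1 := by
    ext x; simp [M]
  have e2 : (ρ₀.prod (surf d)).restrict (Iio 1 ×ˢ univ) = (radial d).prod (surf d) := by
    rw [← Measure.prod_restrict, Measure.restrict_univ, hρ₀,
      restrict_withDensity measurableSet_Iio, Measure.restrict_restrict measurableSet_Iio]
    congr 3
    ext r; simp [and_comm]
  rwa [e1, e2] at hres

/-- This map composed after the one of `exists_polar` is the identity, so it pushes the image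
measure back. -/
theorem measurePreserving_polar {d : ℕ} (hd : 1 ≤ d) :
    MeasurePreserving (fun q : ℝ × Sph d => q.1 • (q.2 : Euc d))
      ((radial d).prod (surf d)) (volBall d) := by
  obtain ⟨M, hM, -, hM2⟩ := exists_polar hd
  have hP : Measurable (fun q : ℝ × Sph d => q.1 • (q.2 : Euc d)) := by fun_prop
  refine ⟨hP, ?_⟩
  rw [← hM.map_eq, Measure.map_map hP hM.measurable]
  convert Measure.map_id
  ext1 x
  exact hM2 x

/-- A square integrable function of `(r,θ)` descends to the unit ball. -/
theorem exists_memLp_ball {d : ℕ} (hd : 1 ≤ d) {E : Type*} [NormedAddCommGroup E]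
    {g : ℝ × Sph d → E} (hg : MemLp g 2 ((radial d).prod (surf d))) :
    ∃ f : Lp E 2 (volBall d),
      ∀ᵐ q ∂((radial d).prod (surf d)), f (q.1 • (q.2 : Euc d)) = g q := by
  obtain ⟨M, hM, hM1, hM2⟩ := exists_polar hd
  have hf := hg.comp_measurePreserving hM
  refine ⟨hf.toLp, ?_⟩
  have h1 := (measurePreserving_polar hd).quasiMeasurePreserving.ae hf.coeFn_toLp
  have h2 : ∀ᵐ q ∂((radial d).prod (surf d)), q.1 ∈ Ioo (0 : ℝ) 1 :=
    Measure.quasiMeasurePreserving_fst.ae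
      (p := fun r => r ∈ Ioo (0 : ℝ) 1) (radial_ae_iff.2 (ae_restrict_mem measurableSet_Ioo))
  filter_upwards [h1, h2] with q hq hpos
  rw [hq, Function.comp_apply]
  congr 1
  have e1 : (M (q.1 • (q.2 : Euc d))).1 = q.1 := by
    rw [hM1, norm_smul, norm_eq_of_mem_sphere, mul_one, Real.norm_of_nonneg hpos.1.le]
  have e2 := hM2 (q.1 • (q.2 : Euc d))
  rw [e1] at e2
  exact Prod.ext e1 (Subtype.ext (smul_right_injective _ hpos.1.ne' e2))

end polar

/-! ### Gauss-Green and integration on the unit ball. -/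

section ball

theorem ae_bounded_volBall {d : ℕ} {w : Euc d → ℝ} (hw : Continuous w) :
    ∃ C, ∀ᵐ x ∂(volBall d), ‖w x‖ ≤ C := by
  obtain ⟨C, hC⟩ := (isCompact_closedBall (0 : Euc d) 1).exists_bound_of_continuousOn
    hw.continuousOn
  refine ⟨C, ?_⟩
  filter_upwards [ae_restrict_mem measurableSet_ball] with x hx
  exact hC x (Metric.ball_subset_closedBall hx)

theorem integrable_ball_mul {d : ℕ} (f : Lp ℝ 2 (volBall d)) {w : Euc d → ℝ} (hw : Continuous w) :
    Integrable (fun x => f x * w x) (volBall d) := by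
  obtain ⟨C, hC⟩ := ae_bounded_volBall hw
  exact ((Lp.memLp f).integrable (by norm_num)).mul_bdd hw.aestronglyMeasurable hC

theorem integrable_ball_mul_inner {d : ℕ} (g : Lp (Euc d) 2 (volBall d)) (v : Euc d)
    {w : Euc d → ℝ} (hw : Continuous w) :
    Integrable (fun x => w x * inner ℝ (g x) v) (volBall d) := by
  obtain ⟨C, hC⟩ := ae_bounded_volBall hw
  exact (((Lp.memLp g).integrable (by norm_num)).inner_const v).bdd_mul
    hw.aestronglyMeasurable hC

theorem continuous_fderiv_apply {d : ℕ} {φ : Euc d → ℝ} (hφ : ContDiff ℝ ∞ φ) (v : Euc d) :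
    Continuous fun x => fderiv ℝ φ x v :=
  (hφ.continuous_fderiv (by simp)).clm_apply continuous_const

/-- The Gauss-Green formula contains the definition of the weak gradient. -/
theorem isWeakGradBall_of_gaussGreen {d : ℕ} {f : Lp ℝ 2 (volBall d)}
    {g : Lp (Euc d) 2 (volBall d)} {c : L2Sph d}
    (h : ∀ φ : Euc d → ℝ, ContDiff ℝ ∞ φ → ∀ v : Euc d,
      ∫ x, (f x * fderiv ℝ φ x v + φ x * inner ℝ (g x) v) ∂(volBall d)
        = ∫ θ : Sph d, c θ * φ θ * inner ℝ v (θ : Euc d) ∂(surf d)) :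
    IsWeakGradBall f g := by
  intro φ hφ _ hs v
  have h0 := h φ hφ v
  have hz : ∀ θ : Sph d, φ θ = 0 := fun θ => by
    refine image_eq_zero_of_notMem_tsupport fun hθ => ?_
    have := hs hθ
    rw [mem_ball_zero_iff, norm_eq_of_mem_sphere] at this
    exact lt_irrefl _ this
  simp only [hz, mul_zero, zero_mul, integral_zero] at h0
  rw [integral_add (integrable_ball_mul f (continuous_fderiv_apply hφ v))
    (integrable_ball_mul_inner g v hφ.continuous)] at h0
  linarith

/-- Integration over the unit ball in polar coordinates. -/
theorem integral_volBall_polar {d : ℕ} (hd : 1 ≤ d) {f : Euc d → ℝ}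
    (hf : Integrable f (volBall d)) :
    ∫ x, f x ∂(volBall d)
      = ∫ r in Ioo (0 : ℝ) 1, r ^ (d - 1) * ∫ θ : Sph d, f (r • (θ : Euc d)) ∂(surf d) := by
  have hP := measurePreserving_polar hd
  have h1 : Integrable (fun q : ℝ × Sph d => f (q.1 • (q.2 : Euc d)))
      ((radial d).prod (surf d)) := (hP.integrable_comp hf.aestronglyMeasurable).2 hf
  rw [← integral_radial, ← integral_prod _ h1]
  conv_lhs => rw [← hP.map_eq]
  exact integral_map hP.measurable.aemeasurable (by rw [hP.map_eq]; exact hf.aestronglyMeasurable)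

end ball

/-! ### Radial test curves and integration by parts in r. -/

section testCurve

variable {d : ℕ} {φ : Euc d → ℝ}

theorem continuous_radial_test (hφ : ContDiff ℝ ∞ φ) (v : Euc d) {b : ℝ} (hb : 0 ≤ b) :
    Continuous fun q : ℝ × Sph d =>
      q.1 ^ b * φ (q.1 • (q.2 : Euc d)) * inner ℝ v (q.2 : Euc d) := by
  have h1 : Continuous φ := hφ.continuous
  have h2 : Continuous fun r : ℝ => r ^ b := Real.continuous_rpow_const hb
  fun_prop

theorem continuous_radial_test_deriv (hφ : ContDiff ℝ ∞ φ) (v : Euc d) {b : ℝ} (hb : 1 ≤ b) :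
    Continuous fun q : ℝ × Sph d =>
      (b * q.1 ^ (b - 1) * φ (q.1 • (q.2 : Euc d))
        + q.1 ^ b * fderiv ℝ φ (q.1 • (q.2 : Euc d)) q.2) * inner ℝ v (q.2 : Euc d) := by
  have h1 : Continuous φ := hφ.continuous
  have h0 : Continuous (fderiv ℝ φ) := hφ.continuous_fderiv (by simp)
  have h2 : Continuous fun r : ℝ => r ^ b := Real.continuous_rpow_const (by linarith)
  have h3 : Continuous fun r : ℝ => r ^ (b - 1) := Real.continuous_rpow_const (by linarith)
  fun_prop

/-- The curve `r ↦ r^b φ(rθ) v·θ` in `C(∂B₁)`. -/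
noncomputable def testCurve (hφ : ContDiff ℝ ∞ φ) (v : Euc d) {b : ℝ} (hb : 1 ≤ b) :
    C(ℝ, C(Sph d, ℝ)) :=
  ContinuousMap.curry ⟨_, continuous_radial_test hφ v (zero_le_one.trans hb)⟩

/-- The derivative of `testCurve` in `r`. -/
noncomputable def testCurveDeriv (hφ : ContDiff ℝ ∞ φ) (v : Euc d) {b : ℝ} (hb : 1 ≤ b) :
    C(ℝ, C(Sph d, ℝ)) :=
  ContinuousMap.curry ⟨_, continuous_radial_test_deriv hφ v hb⟩

theorem integrableOn_testCurveDeriv (hφ : ContDiff ℝ ∞ φ) (v : Euc d) {b : ℝ} (hb : 1 ≤ b)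
    (x y : ℝ) : IntegrableOn (testCurveDeriv hφ v hb) (Ioo x y) :=
  ((testCurveDeriv hφ v hb).continuous.continuousOn.integrableOn_compact
    isCompact_Icc).mono_set Ioo_subset_Icc_self

/-- The fundamental theorem of calculus at each θ. The bound b ≥ 1 makes the curve differentiable up
to r = 0, where it vanishes. -/
theorem testCurve_eq_integral (hφ : ContDiff ℝ ∞ φ) (v : Euc d) {b : ℝ} (hb : 1 ≤ b)
    {r : ℝ} (hr : 0 ≤ r) :
    testCurve hφ v hb r = ∫ s in Ioo 0 r, testCurveDeriv hφ v hb s := by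
  ext θ
  rw [ContinuousMap.integral_apply (integrableOn_testCurveDeriv hφ v hb 0 r),
    ← integral_Ioc_eq_integral_Ioo, ← intervalIntegral.integral_of_le hr]
  have hder : ∀ s ∈ uIcc 0 r, HasDerivAt (fun s => testCurve hφ v hb s θ)
      (testCurveDeriv hφ v hb s θ) s := by
    intro s _
    have h1 : HasDerivAt (fun s : ℝ => s ^ b) (b * s ^ (b - 1)) s :=
      Real.hasDerivAt_rpow_const (Or.inr hb)
    have h2 : HasDerivAt (fun s : ℝ => s • (θ : Euc d)) (θ : Euc d) s := by
      simpa using (hasDerivAt_id s).smul_const (θ : Euc d)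
    have h3 : HasDerivAt (fun s : ℝ => φ (s • (θ : Euc d)))
        (fderiv ℝ φ (s • (θ : Euc d)) θ) s :=
      ((hφ.differentiable (by simp)) _).hasFDerivAt.comp_hasDerivAt s h2
    exact (h1.mul h3).mul_const (inner ℝ v (θ : Euc d))
  have hc : Continuous fun s => testCurveDeriv hφ v hb s θ :=
    (continuous_eval_const θ).comp (testCurveDeriv hφ v hb).continuous
  rw [intervalIntegral.integral_eq_sub_of_hasDerivAt hder (hc.intervalIntegrable _ _)]
  have : testCurve hφ v hb 0 θ = 0 := by
    simp [testCurve, Real.zero_rpow (zero_lt_one.trans_le hb).ne']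
  rw [this, sub_zero]

theorem inner_toLp_eq_integral (f : L2Sph d) (g : C(Sph d, ℝ)) :
    inner ℝ f (ContinuousMap.toLp 2 (surf d) ℝ g) = ∫ θ, f θ * g θ ∂(surf d) := by
  rw [L2.inner_def]
  refine integral_congr_ae ?_
  filter_upwards [ContinuousMap.coeFn_toLp (p := 2) (𝕜 := ℝ) (surf d) g] with θ hθ
  rw [hθ]
  simp [mul_comm]

/-- The test curve vanishes at the origin, so the only boundary term is the one at r = 1; it becomes
the trace term of Gauss-Green. -/
theorem integral_testCurve (hφ : ContDiff ℝ ∞ φ) (v : Euc d) {b : ℝ} (hb : 1 ≤ b)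
    {U U' : ℝ → L2Sph d} (hU' : IntegrableOn U' (Ioo 0 1))
    (hU : ∀ r ∈ Ioo (0 : ℝ) 1, U 1 - U r = ∫ s in Ioo r 1, U' s) :
    ∫ r in Ioo (0 : ℝ) 1, ((∫ θ, U r θ * testCurveDeriv hφ v hb r θ ∂(surf d))
        + ∫ θ, U' r θ * testCurve hφ v hb r θ ∂(surf d))
      = ∫ θ, U 1 θ * φ θ * inner ℝ v (θ : Euc d) ∂(surf d) := by
  let J : C(Sph d, ℝ) →L[ℝ] L2Sph d := ContinuousMap.toLp 2 (surf d) ℝ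
  obtain ⟨i1, i2, h⟩ := integral_bilin_primitive (innerSL ℝ (E := L2Sph d)) hU'
    (B := fun r => J (testCurve hφ v hb r)) (B' := fun r => J (testCurveDeriv hφ v hb r))
    (J.integrable_comp (integrableOn_testCurveDeriv hφ v hb 0 1)) hU (fun r hr => by
      rw [ContinuousLinearMap.integral_comp_comm _ (integrableOn_testCurveDeriv hφ v hb 0 r),
        ← testCurve_eq_integral hφ v hb hr.1.le])
  simp only [← inner_toLp_eq_integral]
  refine (integral_add i1 i2).trans (h.trans ((inner_toLp_eq_integral _ _).trans ?_))
  simp [testCurve, mul_assoc]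

end testCurve

/-! ### From curves in H¹(∂B₁) to functions in H¹(B₁). -/

section construction

variable {d : ℕ}

theorem fderiv_comp_smul {φ : Euc d → ℝ} (hφ : ContDiff ℝ ∞ φ) (r : ℝ) (x w : Euc d) :
    fderiv ℝ (fun y => φ (r • y)) x w = r * fderiv ℝ φ (r • x) w := by
  have h1 : HasFDerivAt (fun y : Euc d => r • y) (r • ContinuousLinearMap.id ℝ (Euc d)) x :=
    (hasFDerivAt_id x).const_smul r
  have h2 : HasFDerivAt (fun y => φ (r • y)) _ x :=
    ((hφ.differentiable (by simp)) _).hasFDerivAt.comp x h1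
  rw [h2.fderiv]
  simp

/-- The divergence theorem on the sphere of radius `r`, for the gradient of `r^α u(r,θ)` in polar
coordinates. -/
theorem integral_sphere_polar_gradient {φ : Euc d → ℝ} (hφ : ContDiff ℝ ∞ φ) (v : Euc d)
    {α b : ℝ} (hb : 1 ≤ b) (hbα : b = α + ((d : ℝ) - 1)) (hd : 1 ≤ d) (c : H1Sph d) (c' : L2Sph d)
    {r : ℝ} (hr : 0 < r) :
    r ^ (d - 1) * ∫ θ : Sph d, (r ^ α * toL2 c θ * fderiv ℝ φ (r • (θ : Euc d)) v
        + φ (r • (θ : Euc d)) * (r ^ (α - 1) * inner ℝ (gradSph c θ) v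
          + (α * r ^ (α - 1) * toL2 c θ + r ^ α * c' θ) * inner ℝ v (θ : Euc d))) ∂(surf d)
      = (∫ θ, toL2 c θ * testCurveDeriv hφ v hb r θ ∂(surf d))
        + ∫ θ, c' θ * testCurve hφ v hb r θ ∂(surf d) := by
  have hφr : ContDiff ℝ ∞ fun y : Euc d => φ (r • y) := hφ.comp (contDiff_const_smul r)
  have hs : ∫ θ : Sph d, toL2 c θ * (fderiv ℝ (fun y => φ (r • y)) (θ : Euc d) (tang v θ)
        - ((d : ℝ) - 1) * φ (r • (θ : Euc d)) * inner ℝ v (θ : Euc d)) ∂(surf d)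
      = - ∫ θ : Sph d, φ (r • (θ : Euc d)) * inner ℝ (gradSph c θ) v ∂(surf d) := c.2 _ hφr v
  have hw := continuous_weight hφr v
  have hφc : Continuous fun θ : Sph d => φ (r • (θ : Euc d)) :=
    hφr.continuous.comp continuous_subtype_val
  obtain ⟨C₁, hC₁⟩ := exists_bound_sph hw
  obtain ⟨C₂, hC₂⟩ := exists_bound_sph hφc
  have i1 := integrable_mul_of_L2 (toL2 c) hw.aestronglyMeasurable hC₁
  have i2 := integrable_mul_inner_of_L2 (gradSph c) v hφc.aestronglyMeasurable hC₂
  have i3 : ∀ (f : L2Sph d) (g : C(Sph d, ℝ)), Integrable (fun θ => f θ * g θ) (surf d) :=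
    fun f g => integrable_mul_of_L2 f g.continuous.aestronglyMeasurable (g.norm_coe_le_norm)
  have i4 := i3 (toL2 c) (testCurveDeriv hφ v hb r)
  have i5 := i3 c' (testCurve hφ v hb r)
  -- Split v into its tangential part and (v·θ)θ. The radial terms form the derivative of r^b φ(rθ)
  -- v·θ, except that b = α + (d-1) creates a surplus (d-1)-term. The weight in `IsWeakGradSph`
  -- absorbs it, and the last bracket integrates to zero by `hs`.
  have key : ∀ θ : Sph d,
      r ^ (d - 1) * (r ^ α * toL2 c θ * fderiv ℝ φ (r • (θ : Euc d)) v
        + φ (r • (θ : Euc d)) * (r ^ (α - 1) * inner ℝ (gradSph c θ) v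
          + (α * r ^ (α - 1) * toL2 c θ + r ^ α * c' θ) * inner ℝ v (θ : Euc d)))
      = (toL2 c θ * testCurveDeriv hφ v hb r θ + c' θ * testCurve hφ v hb r θ)
        + r ^ (b - 1) * (toL2 c θ * (fderiv ℝ (fun y => φ (r • y)) (θ : Euc d) (tang v θ)
            - ((d : ℝ) - 1) * φ (r • (θ : Euc d)) * inner ℝ v (θ : Euc d))
          + φ (r • (θ : Euc d)) * inner ℝ (gradSph c θ) v) := by
    intro θ
    have e1 : testCurveDeriv hφ v hb r θ = (b * r ^ (b - 1) * φ (r • (θ : Euc d))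
        + r ^ b * fderiv ℝ φ (r • (θ : Euc d)) θ) * inner ℝ v (θ : Euc d) := rfl
    have e2 : testCurve hφ v hb r θ = r ^ b * φ (r • (θ : Euc d)) * inner ℝ v (θ : Euc d) := rfl
    have e3 : fderiv ℝ φ (r • (θ : Euc d)) v = fderiv ℝ φ (r • (θ : Euc d)) (tang v θ)
        + inner ℝ v (θ : Euc d) * fderiv ℝ φ (r • (θ : Euc d)) θ := by
      simp [tang]
    have e4 : r ^ b = r * r ^ (b - 1) := by
      rw [← Real.rpow_one_add' hr.le (by linarith)]; congr 1; ring
    have e6 : r ^ (b - 1) = r ^ (α - 1) * r ^ (d - 1) := by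
      rw [← Real.rpow_natCast, ← Real.rpow_add hr, hbα, Nat.cast_sub hd]; congr 1; push_cast; ring
    have e5 : r ^ α = r * r ^ (α - 1) := by
      rw [Real.rpow_sub_one hr.ne']; field_simp
    rw [e1, e2, fderiv_comp_smul hφ, e3, e4, e6, e5, hbα]
    ring
  rw [← integral_const_mul]
  simp_rw [key]
  refine (integral_add (i4.add i5) ((i1.add i2).const_mul _)).trans ?_
  rw [integral_add' i4 i5, integral_const_mul, integral_add' i1 i2, hs]
  ring

/-- A curve `u` in `H¹(∂B₁)` with radial derivative `u'` in `L²(∂B₁)` gives a function `r^α u(r,θ)`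
in `H¹(B₁)` with trace `u(1)`. -/
theorem exists_h1Ball_of_polar (hd : 2 ≤ d) {α : ℝ} (hα : 0 < α) {u : ℝ → H1Sph d}
    {u' : ℝ → L2Sph d}
    (h1 : MemLp (fun r => r ^ α • toL2 (u r)) 2 (radial d))
    (h2 : MemLp (fun r => r ^ (α - 1) • gradSph (u r)) 2 (radial d))
    (h3 : MemLp (fun r => (α * r ^ (α - 1)) • toL2 (u r) + r ^ α • u' r) 2 (radial d))
    (hu' : IntegrableOn u' (Ioo 0 1))
    (hu : ∀ r ∈ Ioo (0 : ℝ) 1, toL2 (u 1) - toL2 (u r) = ∫ s in Ioo r 1, u' s) :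
    ∃ h : H1Ball d, EqPolar h α u ∧ HasTrace h (toL2 (u 1)) := by
  have hd1 : 1 ≤ d := by omega
  obtain ⟨g₁, m₁, s₁⟩ := exists_memLp_uncurry h1
  obtain ⟨g₂, m₂, s₂⟩ := exists_memLp_uncurry h2
  obtain ⟨g₃, m₃, s₃⟩ := exists_memLp_uncurry h3
  -- The candidate gradient is the tangential part plus the radial derivative of r^α u times the
  -- unit normal θ.
  have m₄ : MemLp (fun q : ℝ × Sph d => g₂ q + g₃ q • (q.2 : Euc d)) 2
      ((radial d).prod (surf d)) := by
    refine m₂.add (m₃.of_le (m₃.aestronglyMeasurable.smul ?_) (Filter.Eventually.of_forall ?_))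
    · exact (continuous_subtype_val.comp continuous_snd).aestronglyMeasurable
    · intro q; simp [norm_smul]
  obtain ⟨f, hf⟩ := exists_memLp_ball hd1 m₁
  obtain ⟨g, hg⟩ := exists_memLp_ball hd1 m₄
  have hf' := radial_ae_iff.1 (Measure.ae_ae_of_ae_prod hf)
  have hg' := radial_ae_iff.1 (Measure.ae_ae_of_ae_prod hg)
  rw [radial_ae_iff] at s₁ s₂ s₃
  have hb : 1 ≤ α + ((d : ℝ) - 1) := by
    have : (2 : ℝ) ≤ d := by exact_mod_cast hd
    linarith
  have hpol : ∀ᵐ r ∂(volume.restrict (Ioo (0 : ℝ) 1)), ∀ᵐ θ : Sph d ∂(surf d),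
      f (r • (θ : Euc d)) = r ^ α * toL2 (u r) θ := by
    filter_upwards [hf', s₁] with r a1 a2
    filter_upwards [a1, a2, Lp.coeFn_smul (r ^ α) (toL2 (u r))] with θ b1 b2 b3
    rw [b1, b2, b3]; rfl
  have hgrad : ∀ᵐ r ∂(volume.restrict (Ioo (0 : ℝ) 1)), ∀ᵐ θ : Sph d ∂(surf d),
      ∀ v : Euc d, inner ℝ (g (r • (θ : Euc d))) v = r ^ (α - 1) * inner ℝ (gradSph (u r) θ) v
          + (α * r ^ (α - 1) * toL2 (u r) θ + r ^ α * u' r θ) * inner ℝ v (θ : Euc d) := by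
    filter_upwards [hg', s₂, s₃] with r a1 a2 a3
    filter_upwards [a1, a2, a3, Lp.coeFn_smul (r ^ (α - 1)) (gradSph (u r)),
      Lp.coeFn_add ((α * r ^ (α - 1)) • toL2 (u r)) (r ^ α • u' r),
      Lp.coeFn_smul (α * r ^ (α - 1)) (toL2 (u r)), Lp.coeFn_smul (r ^ α) (u' r)]
      with θ b1 b2 b3 b4 b5 b6 b7 v
    rw [b1, b2, b3, b4, b5, Pi.add_apply, b6, b7, inner_add_left, Pi.smul_apply,
      real_inner_smul_left, real_inner_smul_left, real_inner_comm v (θ : Euc d)]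
    rfl
  have htr : ∀ φ : Euc d → ℝ, ContDiff ℝ ∞ φ → ∀ v : Euc d,
      ∫ x, (f x * fderiv ℝ φ x v + φ x * inner ℝ (g x) v) ∂(volBall d)
        = ∫ θ : Sph d, toL2 (u 1) θ * φ θ * inner ℝ v (θ : Euc d) ∂(surf d) := by
    intro φ hφ v
    refine (integral_volBall_polar hd1 ((integrable_ball_mul f
      (continuous_fderiv_apply hφ v)).add
      (integrable_ball_mul_inner g v hφ.continuous))).trans ?_
    rw [← integral_testCurve hφ v hb hu' hu]
    refine integral_congr_ae ?_
    filter_upwards [hpol, hgrad, ae_restrict_mem measurableSet_Ioo] with r a1 a2 hr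
    rw [← integral_sphere_polar_gradient hφ v hb rfl hd1 (u r) (u' r) hr.1]
    congr 1
    refine integral_congr_ae ?_
    filter_upwards [a1, a2] with θ b1 b2
    simp only [Pi.add_apply, b1, b2 v]
  exact ⟨⟨WithLp.toLp 2 (f, g), isWeakGradBall_of_gaussGreen htr⟩, hpol, htr⟩

end construction

/-! ### The substitution t = -κ ln r. -/

section logTime

variable {E : Type*} [NormedAddCommGroup E] [NormedSpace ℝ E]

theorem hasDerivAt_exp_neg_div (κ t : ℝ) :
    HasDerivAt (fun t => Real.exp (-t / κ)) (-(κ⁻¹ * Real.exp (-t / κ))) t := by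
  have h : HasDerivAt (fun t => Real.exp (-t / κ)) (Real.exp (-t / κ) * (-1 / κ)) t :=
    (((hasDerivAt_id t).neg).div_const κ).exp
  convert h using 1
  ring

theorem injOn_exp_neg_div {κ : ℝ} (hκ : 0 < κ) (s : Set ℝ) :
    InjOn (fun t => Real.exp (-t / κ)) s := by
  intro x _ y _ h
  have h1 := Real.exp_injective h
  field_simp at h1
  linarith

theorem abs_deriv_exp_neg_div {κ : ℝ} (hκ : 0 < κ) (t : ℝ) :
    |(-(κ⁻¹ * Real.exp (-t / κ)))| = κ⁻¹ * Real.exp (-t / κ) := by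
  rw [abs_neg, abs_of_pos (by positivity)]

theorem neg_mul_log_exp {κ : ℝ} (hκ : 0 < κ) (t : ℝ) :
    -κ * Real.log (Real.exp (-t / κ)) = t := by
  rw [Real.log_exp]; field_simp

theorem exp_neg_div_log {κ : ℝ} (hκ : 0 < κ) {r : ℝ} (hr : 0 < r) :
    Real.exp (-(-κ * Real.log r) / κ) = r := by
  have : -(-κ * Real.log r) / κ = Real.log r := by field_simp
  rw [this, Real.exp_log hr]

theorem neg_mul_log_pos {κ : ℝ} (hκ : 0 < κ) {r : ℝ} (hr : r ∈ Ioo (0 : ℝ) 1) :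
    0 < -κ * Real.log r := by
  nlinarith [Real.log_neg hr.1 hr.2]

theorem neg_mul_log_lt_iff {κ : ℝ} (hκ : 0 < κ) {r t : ℝ} (hr : 0 < r) :
    -κ * Real.log r < t ↔ Real.exp (-t / κ) < r := by
  rw [← Real.lt_log_iff_exp_lt hr, div_lt_iff₀ hκ]
  constructor <;> intro h <;> linarith

theorem image_exp_neg_div_Ioo {κ : ℝ} (hκ : 0 < κ) {r : ℝ} (hr : 0 < r) :
    (fun t => Real.exp (-t / κ)) '' Ioo 0 (-κ * Real.log r) = Ioo r 1 := by
  ext x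
  constructor
  · rintro ⟨t, ⟨ht0, ht1⟩, rfl⟩
    refine ⟨?_, ?_⟩
    · nth_rewrite 1 [← exp_neg_div_log hκ hr]
      exact Real.exp_lt_exp.2 (by gcongr)
    · exact Real.exp_lt_one_iff.2 (div_neg_of_neg_of_pos (by linarith) hκ)
  · rintro ⟨h1, h2⟩
    have hx : 0 < x := hr.trans h1
    refine ⟨-κ * Real.log x, ⟨neg_mul_log_pos hκ ⟨hx, h2⟩, ?_⟩, exp_neg_div_log hκ hx⟩
    nlinarith [Real.log_lt_log hr h1]

theorem image_exp_neg_div_Ioi {κ : ℝ} (hκ : 0 < κ) :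
    (fun t => Real.exp (-t / κ)) '' Ioi 0 = Ioo 0 1 := by
  ext x
  constructor
  · rintro ⟨t, ht, rfl⟩
    exact ⟨Real.exp_pos _, Real.exp_lt_one_iff.2 (div_neg_of_neg_of_pos (by simpa using ht) hκ)⟩
  · rintro ⟨h1, h2⟩
    exact ⟨-κ * Real.log x, neg_mul_log_pos hκ ⟨h1, h2⟩, exp_neg_div_log hκ h1⟩

/-- The substitution `t = -κ ln s`. -/
theorem integral_log_subst {κ : ℝ} (hκ : 0 < κ) {r : ℝ} (hr : 0 < r) (g : ℝ → E) :
    ∫ s in Ioo r 1, (-κ * s⁻¹) • g (-κ * Real.log s) = -∫ t in Ioo 0 (-κ * Real.log r), g t := by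
  rw [← image_exp_neg_div_Ioo hκ hr, integral_image_eq_integral_abs_deriv_smul measurableSet_Ioo
    (fun t _ => (hasDerivAt_exp_neg_div κ t).hasDerivWithinAt) (injOn_exp_neg_div hκ _),
    ← integral_neg]
  congr 1
  ext t
  rw [neg_mul_log_exp hκ, abs_deriv_exp_neg_div hκ, smul_smul, ← neg_one_smul ℝ (g t)]
  congr 1
  field_simp

theorem integrableOn_log_subst {κ : ℝ} (hκ : 0 < κ) {g : ℝ → E} (hg : IntegrableOn g (Ioi 0)) :
    IntegrableOn (fun s => (-κ * s⁻¹) • g (-κ * Real.log s)) (Ioo 0 1) := by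
  rw [← image_exp_neg_div_Ioi hκ, integrableOn_image_iff_integrableOn_abs_deriv_smul
    measurableSet_Ioi (fun t _ => (hasDerivAt_exp_neg_div κ t).hasDerivWithinAt)
    (injOn_exp_neg_div hκ _)]
  refine hg.neg.congr (Filter.Eventually.of_forall fun t => ?_)
  simp only [Pi.neg_apply]
  rw [neg_mul_log_exp hκ, abs_deriv_exp_neg_div hκ, smul_smul, ← neg_one_smul ℝ (g t)]
  congr 1
  field_simp

/-- The image of Lebesgue measure on `(0,1)` under `r ↦ -κ ln r`. -/
noncomputable def expMeasure (κ : ℝ) : Measure ℝ :=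
  (volume.restrict (Ioi (0 : ℝ))).withDensity fun t => ENNReal.ofReal (κ⁻¹ * Real.exp (-t / κ))

theorem measurePreserving_log {κ : ℝ} (hκ : 0 < κ) :
    MeasurePreserving (fun r => -κ * Real.log r) (volume.restrict (Ioo (0 : ℝ) 1))
      (expMeasure κ) := by
  have he : Measurable fun t : ℝ => Real.exp (-t / κ) := by fun_prop
  have hl : Measurable fun r : ℝ => -κ * Real.log r := by fun_prop
  have h1 : Measure.map (fun t => Real.exp (-t / κ)) (expMeasure κ)
      = volume.restrict (Ioo (0 : ℝ) 1) := by
    ext s hs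
    rw [Measure.map_apply he hs, expMeasure, withDensity_apply _ (he hs),
      ← lintegral_indicator_one hs, ← image_exp_neg_div_Ioi hκ,
      lintegral_image_eq_lintegral_abs_deriv_mul measurableSet_Ioi
        (fun t _ => (hasDerivAt_exp_neg_div κ t).hasDerivWithinAt) (injOn_exp_neg_div hκ _),
      ← lintegral_indicator (he hs)]
    congr 1
    ext t
    rw [abs_deriv_exp_neg_div hκ]
    by_cases h : Real.exp (-t / κ) ∈ s
    · simp [indicator, h]
    · simp [indicator, h]
  refine ⟨hl, ?_⟩
  rw [← h1, Measure.map_map hl he]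
  convert Measure.map_id
  ext1 t
  exact neg_mul_log_exp hκ t

theorem expMeasure_le {κ : ℝ} (hκ : 0 < κ) :
    expMeasure κ ≤ ENNReal.ofReal κ⁻¹ • volume.restrict (Ioi (0 : ℝ)) := by
  rw [expMeasure, ← withDensity_const]
  refine withDensity_mono ?_
  filter_upwards [ae_restrict_mem measurableSet_Ioi] with t ht
  refine ENNReal.ofReal_le_ofReal (mul_le_of_le_one_right (by positivity) ?_)
  exact Real.exp_le_one_iff.2 (div_nonpos_of_nonpos_of_nonneg (by simpa using le_of_lt ht) hκ.le)

theorem isFiniteMeasure_expMeasure {κ : ℝ} (hκ : 0 < κ) : IsFiniteMeasure (expMeasure κ) := by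
  rw [← (measurePreserving_log hκ).map_eq]
  infer_instance

/-- On (0,T) the image measure has density at most 1/κ, so square integrability of f carries over;
the constant tail is harmless because the measure is finite. -/
theorem memLp_log_subst {F : Type*} [NormedAddCommGroup F] {κ T : ℝ} (hκ : 0 < κ)
    {f : ℝ → F}
    (hf : MemLp f 2 (volume.restrict (Ioo 0 T))) (f₀ : F) :
    MemLp (fun r => if -κ * Real.log r < T then f (-κ * Real.log r) else f₀) 2
      (volume.restrict (Ioo (0 : ℝ) 1)) := by
  have := isFiniteMeasure_expMeasure hκ
  have h1 : MemLp ((Ioo 0 T).indicator f) 2 (expMeasure κ) := by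
    rw [memLp_indicator_iff_restrict measurableSet_Ioo]
    refine MemLp.of_measure_le_smul (c := ENNReal.ofReal κ⁻¹) (by simp) ?_ hf
    calc (expMeasure κ).restrict (Ioo 0 T)
        ≤ (ENNReal.ofReal κ⁻¹ • volume.restrict (Ioi (0 : ℝ))).restrict (Ioo 0 T) :=
          Measure.restrict_mono le_rfl (expMeasure_le hκ)
      _ = ENNReal.ofReal κ⁻¹ • volume.restrict (Ioo 0 T) := by
          rw [Measure.restrict_smul, Measure.restrict_restrict measurableSet_Ioo,
            inter_eq_left.2 Ioo_subset_Ioi_self]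
  have h2 : MemLp ((Ici T).indicator fun _ => f₀) 2 (expMeasure κ) :=
    (memLp_const f₀).indicator measurableSet_Ici
  refine ((h1.add h2).comp_measurePreserving (measurePreserving_log hκ)).ae_eq ?_
  filter_upwards [ae_restrict_mem measurableSet_Ioo] with r hr
  have h0 := neg_mul_log_pos hκ hr
  simp only [Function.comp_apply, Pi.add_apply, indicator, mem_Ioo, mem_Ici, h0, true_and]
  by_cases h : -κ * Real.log r < T
  · rw [if_pos h, if_pos h, if_neg (not_le.2 h), add_zero]
  · rw [if_neg h, if_neg h, if_pos (not_lt.1 h), zero_add]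

end logTime

/-! ### Power weights at the origin. -/

section weights

variable {E : Type*} [NormedAddCommGroup E] [NormedSpace ℝ E]

/-- A power weight does not matter for functions that vanish near the origin. -/
theorem memLp_rpow_smul_of_eq_zero {v : ℝ → E} (hv : MemLp v 2 (volume.restrict (Ioo (0 : ℝ) 1)))
    {δ : ℝ} (hδ : 0 < δ) (h0 : ∀ r ∈ Ioo 0 δ, v r = 0) (s : ℝ) :
    MemLp (fun r => r ^ s • v r) 2 (volume.restrict (Ioo (0 : ℝ) 1)) := by
  refine MemLp.of_le_mul (c := max 1 (δ ^ s)) hv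
    ((measurable_id.pow_const s).aestronglyMeasurable.smul hv.aestronglyMeasurable) ?_
  filter_upwards [ae_restrict_mem measurableSet_Ioo] with r hr
  by_cases h : r < δ
  · rw [h0 r ⟨hr.1, h⟩]; simp
  · rw [norm_smul, Real.norm_of_nonneg (Real.rpow_nonneg hr.1.le _)]
    gcongr
    rcases le_total 0 s with hs | hs
    · exact le_max_of_le_left (Real.rpow_le_one hr.1.le hr.2.le hs)
    · exact le_max_of_le_right (Real.rpow_le_rpow_of_nonpos hδ (not_lt.1 h) hs)

theorem radial_le (d : ℕ) : radial d ≤ volume.restrict (Ioo (0 : ℝ) 1) := by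
  conv_rhs => rw [← withDensity_one (μ := volume.restrict (Ioo (0 : ℝ) 1))]
  refine withDensity_mono ?_
  filter_upwards [ae_restrict_mem measurableSet_Ioo] with r hr
  exact ENNReal.ofReal_le_one.2 (pow_le_one₀ hr.1.le hr.2.le)

theorem integrableOn_rpow_Ioo {s : ℝ} (hs : -1 < s) :
    IntegrableOn (fun r : ℝ => r ^ s) (Ioo 0 1) :=
  ((intervalIntegrable_iff_integrableOn_Ioo_of_le zero_le_one).1
    (intervalIntegral.intervalIntegrable_rpow' hs))

theorem memLp_rpow_radial {d : ℕ} (hd : 1 ≤ d) {s : ℝ} (hs : 0 < 2 * s + d) :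
    MemLp (fun r : ℝ => r ^ s) 2 (radial d) := by
  have hm : AEStronglyMeasurable (fun r : ℝ => r ^ s) (radial d) :=
    (measurable_id.pow_const s).aestronglyMeasurable
  rw [memLp_two_iff_integrable_sq hm, radial,
    integrable_withDensity_iff_integrable_smul' (by fun_prop) (by simp)]
  have h := integrableOn_rpow_Ioo (s := 2 * s + ((d : ℝ) - 1)) (by linarith)
  refine h.congr ?_
  filter_upwards [ae_restrict_mem measurableSet_Ioo] with r hr
  rw [ENNReal.toReal_ofReal (pow_nonneg hr.1.le _), smul_eq_mul, ← Real.rpow_natCast r (d - 1),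
    ← Real.rpow_mul_natCast hr.1.le, ← Real.rpow_add hr.1, Nat.cast_sub hd]
  congr 1
  push_cast
  ring

/-- Subtracting v₀ leaves a function that vanishes near the origin, where any power is allowed. The
remaining r^s v₀ is square integrable because r^(2s+d-1) is integrable at 0. -/
theorem memLp_rpow_smul_radial {d : ℕ} (hd : 1 ≤ d) {v : ℝ → E}
    (hv : MemLp v 2 (volume.restrict (Ioo (0 : ℝ) 1)))
    {δ : ℝ} (hδ : 0 < δ) {v₀ : E} (h0 : ∀ r ∈ Ioo 0 δ, v r = v₀) {s : ℝ} (hs : 0 < 2 * s + d) :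
    MemLp (fun r => r ^ s • v r) 2 (radial d) := by
  have h1 := (memLp_rpow_smul_of_eq_zero (v := fun r => v r - v₀) (hv.sub (memLp_const v₀)) hδ
    (fun r hr => by simp [h0 r hr]) s).mono_measure (radial_le d)
  have h2 : MemLp (fun r : ℝ => r ^ s • v₀) 2 (radial d) := by
    refine MemLp.of_le_mul (c := ‖v₀‖) (memLp_rpow_radial hd hs)
      ((measurable_id.pow_const s).aestronglyMeasurable.smul_const v₀)
      (Filter.Eventually.of_forall fun r => ?_)
    rw [norm_smul, mul_comm]
  refine (h1.add h2).ae_eq (Filter.Eventually.of_forall fun r => ?_)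
  simp [smul_sub]

end weights

/-! ### The stopped flow in logarithmic time. -/

section stopped

variable {d : ℕ}

/-- Integration by parts against η, which vanishes at both ends of the interval. -/
theorem memH1Cylinder_of_primitive {u : ℝ → H1Sph d} {u' : ℝ → L2Sph d}
    (hu : MemLp u 2 (volume.restrict (Ioo (0 : ℝ) 1)))
    (hu' : MemLp u' 2 (volume.restrict (Ioo (0 : ℝ) 1)))
    (h : ∀ r ∈ Ioo (0 : ℝ) 1, toL2 (u 1) - toL2 (u r) = ∫ s in Ioo r 1, u' s) :
    MemH1Cylinder u u' := by
  refine ⟨hu, hu', fun η hη hc hs => ?_⟩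
  have hη0 : ∀ r ∉ Ioo (0 : ℝ) 1, η r = 0 := fun r hr =>
    image_eq_zero_of_notMem_tsupport fun h => hr (hs h)
  have hd' : Continuous (deriv η) := hη.continuous_deriv (by simp)
  obtain ⟨i1, i2, e⟩ := integral_bilin_primitive
    (ContinuousLinearMap.lsmul ℝ ℝ (E := L2Sph d)).flip (B := η) (B' := deriv η)
    (hu'.integrable (by norm_num))
    ((hd'.continuousOn.integrableOn_compact isCompact_Icc).mono_set Ioo_subset_Icc_self) h
    (fun r hr => by
      rw [← integral_Ioc_eq_integral_Ioo, ← intervalIntegral.integral_of_le hr.1.le,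
        intervalIntegral.integral_deriv_eq_sub (fun x _ => (hη.differentiable (by simp)) x)
          (hd'.intervalIntegrable _ _), hη0 0 (by simp), sub_zero])
  simp only [ContinuousLinearMap.flip_apply, ContinuousLinearMap.lsmul_apply,
    hη0 1 (by simp), zero_smul] at e
  exact eq_neg_of_add_eq_zero_left e

variable {T κ : ℝ}

/-- The radial derivative of `r ↦ ψ(min(-κ ln r, T))`. -/
noncomputable def stoppedDeriv {E : Type*} [AddCommGroup E] [Module ℝ E] (κ T : ℝ) (ψ' : ℝ → E)
    (r : ℝ) : E :=
  (-κ * r⁻¹) • if -κ * Real.log r < T then ψ' (-κ * Real.log r) else 0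

/-- The primitive of a curve stopped at time `T`, in the variable `r = exp (-t/κ)`. -/
theorem integral_stoppedDeriv {E : Type*} [NormedAddCommGroup E] [NormedSpace ℝ E] (hκ : 0 < κ)
    {r : ℝ} (hr : r ∈ Ioo (0 : ℝ) 1) (ψ' : ℝ → E) :
    ∫ s in Ioo r 1, stoppedDeriv κ T ψ' s
      = -∫ t in Ioo 0 (min (-κ * Real.log r) T), ψ' t := by
  have h := integral_log_subst hκ hr.1 ((Iio T).indicator ψ')
  rw [setIntegral_indicator measurableSet_Iio, Ioo_inter_Iio] at h
  rw [← h]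
  rfl

theorem integrableOn_stoppedDeriv {E : Type*} [NormedAddCommGroup E] [NormedSpace ℝ E]
    (hκ : 0 < κ) {ψ' : ℝ → E} (h : IntegrableOn ψ' (Ioo 0 T)) :
    IntegrableOn (stoppedDeriv κ T ψ') (Ioo 0 1) := by
  refine integrableOn_log_subst hκ (g := (Iio T).indicator ψ') ?_
  rw [IntegrableOn, integrable_indicator_iff measurableSet_Iio, IntegrableOn,
    Measure.restrict_restrict measurableSet_Iio, inter_comm, Ioi_inter_Iio]
  exact h

/-- Stopping a flow at time `T` and running it in logarithmic time gives a curve in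
`H¹([0,1] × ∂B₁)`, and the corresponding `α`-homogeneous extension is in `H¹(B₁)`. -/
theorem stopped_flow_extension (hd : 2 ≤ d) {α : ℝ} (hα : 0 < α) {ψ : ℝ → H1Sph d}
    {ψ' : ℝ → L2Sph d} (hκ : 0 < κ) (hT : 0 ≤ T)
    (hψ : MemLp ψ 2 (volume.restrict (Ioo 0 T))) (hψ' : MemLp ψ' 2 (volume.restrict (Ioo 0 T)))
    (hprim : ∀ t, 0 ≤ t → t ≤ T → toL2 (ψ t) - toL2 (ψ 0) = ∫ τ in Ioo 0 t, ψ' τ) :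
    MemH1Cylinder (fun r => ψ (min (-κ * Real.log r) T)) (stoppedDeriv κ T ψ') ∧
    ∃ h : H1Ball d, EqPolar h α (fun r => ψ (min (-κ * Real.log r) T)) ∧
      HasTrace h (toL2 (ψ 0)) := by
  set u : ℝ → H1Sph d := fun r => ψ (min (-κ * Real.log r) T) with hudef
  have hd1 : 1 ≤ d := by omega
  have hd2 : (2 : ℝ) ≤ d := by exact_mod_cast hd
  -- The radius reached at time T. Inside it the curve is constant, so the factor 1/r in the radial
  -- derivative is never singular where it matters.
  set δ := Real.exp (-T / κ) with hδdef
  have hδ : 0 < δ := Real.exp_pos _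
  have hge : ∀ r ∈ Ioo 0 δ, ¬ -κ * Real.log r < T := fun r hr h =>
    absurd ((neg_mul_log_lt_iff hκ hr.1).1 h) (not_lt.2 hr.2.le)
  have hu0 : ∀ r ∈ Ioo 0 δ, u r = ψ T := fun r hr => by
    rw [hudef]; simp only; rw [min_eq_right (not_lt.1 (hge r hr))]
  have hu1 : u 1 = ψ 0 := by simp [hudef, hT]
  have hu : MemLp u 2 (volume.restrict (Ioo (0 : ℝ) 1)) := by
    refine (memLp_log_subst hκ hψ (ψ T)).ae_eq (Filter.Eventually.of_forall fun r => ?_)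
    by_cases h : -κ * Real.log r < T
    · simp only [hudef, h, if_true]; rw [min_eq_left h.le]
    · simp only [hudef, h, if_false]; rw [min_eq_right (not_lt.1 h)]
  have hw' := memLp_log_subst hκ hψ' (0 : L2Sph d)
  have hw0 : ∀ r ∈ Ioo 0 δ,
      (if -κ * Real.log r < T then ψ' (-κ * Real.log r) else 0) = 0 := fun r hr => by
    rw [if_neg (hge r hr)]
  have hu' : MemLp (stoppedDeriv κ T ψ') 2 (volume.restrict (Ioo (0 : ℝ) 1)) := by
    refine ((memLp_rpow_smul_of_eq_zero hw' hδ hw0 (-1)).const_smul (-κ)).ae_eq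
      (Filter.Eventually.of_forall fun r => ?_)
    simp only [Pi.smul_apply, stoppedDeriv, Real.rpow_neg_one, smul_smul]
  have hp : ∀ r ∈ Ioo (0 : ℝ) 1,
      toL2 (u 1) - toL2 (u r) = ∫ s in Ioo r 1, stoppedDeriv κ T ψ' s := by
    intro r hr
    rw [integral_stoppedDeriv hκ hr, hu1, ← hprim _
      (le_min (neg_mul_log_pos hκ hr).le hT) (min_le_right _ _)]
    abel
  refine ⟨memH1Cylinder_of_primitive hu hu' hp, ?_⟩
  have hU : MemLp (fun r => toL2 (u r)) 2 (volume.restrict (Ioo (0 : ℝ) 1)) :=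
    toL2.comp_memLp' hu
  have hG : MemLp (fun r => gradSph (u r)) 2 (volume.restrict (Ioo (0 : ℝ) 1)) :=
    ((ContinuousLinearMap.snd ℝ (L2Sph d) (L2SphVec d)).comp
      ((WithLp.prodContinuousLinearEquiv 2 ℝ (L2Sph d) (L2SphVec d)).toContinuousLinearMap.comp
      (H1Sph d).subtypeL)).comp_memLp' hu
  have h3 := (memLp_rpow_smul_radial hd1 hU hδ (v₀ := toL2 (ψ T)) (s := α - 1)
    (fun r hr => by rw [hu0 r hr]) (by linarith)).const_smul α
  have h4 := memLp_rpow_smul_radial hd1 hu' hδ (v₀ := (0 : L2Sph d)) (s := α)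
    (fun r hr => by rw [stoppedDeriv, hw0 r hr, smul_zero]) (by linarith)
  rw [← hu1]
  refine exists_h1Ball_of_polar hd hα
    (memLp_rpow_smul_radial hd1 hU hδ (v₀ := toL2 (ψ T)) (fun r hr => by rw [hu0 r hr])
      (by linarith))
    (memLp_rpow_smul_radial hd1 hG hδ (v₀ := gradSph (ψ T)) (fun r hr => by rw [hu0 r hr])
      (by linarith)) ((h3.add h4).ae_eq (Filter.Eventually.of_forall fun r => ?_))
    (hu'.integrable (by norm_num)) hp
  simp only [Pi.add_apply, Pi.smul_apply, smul_smul]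

end stopped

/-! ### Energy, dissipation and kinetic term along the stopped flow. -/

section energy

variable {a κ T : ℝ} {f dF : ℝ → ℝ}

theorem integral_Ioo_rpow_sub_one (ha : 0 < a) {s r : ℝ} (hr : s ≤ r) :
    ∫ t in Ioo s r, t ^ (a - 1) = (r ^ a - s ^ a) / a := by
  rw [← integral_Ioc_eq_integral_Ioo, ← intervalIntegral.integral_of_le hr,
    integral_rpow (Or.inl (by linarith)), sub_add_cancel]

/-- The energy of a stopped flow in logarithmic time, integrated by parts. -/
theorem integral_stopped_energy (ha : 0 < a) (hκ : 0 < κ) (hT : 0 ≤ T)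
    (hdF : IntegrableOn dF (Ioo 0 T))
    (hf : ∀ t, 0 ≤ t → t ≤ T → f t - f 0 = ∫ τ in Ioo 0 t, dF τ) :
    IntegrableOn (fun r => f (min (-κ * Real.log r) T) * r ^ (a - 1)) (Ioo 0 1) ∧
    IntegrableOn (fun r => stoppedDeriv κ T dF r * r ^ a) (Ioo 0 1) ∧
    ∫ r in Ioo (0 : ℝ) 1, f (min (-κ * Real.log r) T) * r ^ (a - 1)
      = (f 0 - ∫ r in Ioo (0 : ℝ) 1, stoppedDeriv κ T dF r * r ^ a) / a := by
  -- The primitive r^a/a vanishes at 0, so only the initial energy, at r = 1, survives as a boundary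
  -- term.
  obtain ⟨i1, i2, e⟩ := integral_bilin_primitive (ContinuousLinearMap.mul ℝ ℝ)
    (A := fun r => f (min (-κ * Real.log r) T)) (B := fun r => r ^ a / a)
    (B' := fun r : ℝ => r ^ (a - 1)) (integrableOn_stoppedDeriv hκ hdF)
    (integrableOn_rpow_Ioo (by linarith)) (fun r hr => by
      rw [integral_stoppedDeriv hκ hr, ← hf _ (le_min (neg_mul_log_pos hκ hr).le hT)
        (min_le_right _ _)]
      simp [hT]) (fun r hr => by
      rw [integral_Ioo_rpow_sub_one ha hr.1.le, Real.zero_rpow ha.ne', sub_zero])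
  simp only [ContinuousLinearMap.mul_apply', ← mul_div_assoc] at i1 i2 e
  refine ⟨i1, ?_, ?_⟩
  · refine (i2.mul_const a).congr (Filter.Eventually.of_forall fun r => ?_)
    simp only
    field_simp
  · rw [integral_div] at e
    simp only [Real.log_one, mul_zero, min_eq_left hT, Real.one_rpow, mul_one] at e
    rw [sub_div]
    linarith

/-- The substitution carries dr to a measure with a density, so exceptional null sets of times pull
back to null sets of radii. -/
theorem ae_log_subst (hκ : 0 < κ) {P : ℝ → Prop} (h : ∀ᵐ t ∂(volume.restrict (Ioo 0 T)), P t) :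
    ∀ᵐ r ∂(volume.restrict (Ioo (0 : ℝ) 1)), -κ * Real.log r < T → P (-κ * Real.log r) := by
  have h1 : ∀ᵐ t ∂(volume.restrict (Ioi (0 : ℝ))), t < T → P t := by
    rw [ae_restrict_iff' measurableSet_Ioo] at h
    rw [ae_restrict_iff' measurableSet_Ioi]
    filter_upwards [h] with t ht h0 h2 using ht ⟨h0, h2⟩
  exact (measurePreserving_log hκ).quasiMeasurePreserving.ae
    ((withDensity_absolutelyContinuous _ _).ae_le h1)

/-- The energy gained by a stopped flow: either it runs at least for the time `κ`, or it loses
the energy `x`. -/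
theorem le_integral_stopped_dissipation (ha : 0 < a) (hκ : 0 < κ)
    (hdF : IntegrableOn dF (Ioo 0 T)) {m x : ℝ} (hm : 0 ≤ m)
    (hdm : ∀ᵐ t ∂(volume.restrict (Ioo 0 T)), m ≤ - dF t)
    (hcase : κ ≤ T ∨ T ≤ κ ∧ ∫ t in Ioo 0 T, dF t ≤ -x)
    (hint : IntegrableOn (fun r => stoppedDeriv κ T dF r * r ^ a) (Ioo 0 1)) :
    min (κ * m * (1 - Real.exp (-a)) / a) (Real.exp (-a) * x)
      ≤ ∫ r in Ioo (0 : ℝ) 1, stoppedDeriv κ T dF r * r ^ a := by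
  have he0 : 0 < Real.exp (-1) := Real.exp_pos _
  have he1 : Real.exp (-1) < 1 := Real.exp_lt_one_iff.2 (by norm_num)
  have hea : Real.exp (-1) ^ a = Real.exp (-a) := by rw [← Real.exp_mul]; simp
  -- The radius 1/e corresponds to the time κ. Only the shell r > 1/e is kept: there the weight r^a
  -- is at least exp(-a), and the integrand discarded elsewhere is nonnegative.
  have hτ : -κ * Real.log (Real.exp (-1)) = κ := by simp
  have hsub : Ioo (Real.exp (-1)) 1 ⊆ Ioo 0 1 := Ioo_subset_Ioo_left he0.le
  have hae := ae_log_subst hκ hdm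
  have hnn : ∀ᵐ r ∂(volume.restrict (Ioo (0 : ℝ) 1)), 0 ≤ stoppedDeriv κ T dF r := by
    filter_upwards [hae, ae_restrict_mem measurableSet_Ioo] with r h hr
    rw [stoppedDeriv, smul_eq_mul]
    split_ifs with hlt
    · have := h hlt
      have h2 : 0 ≤ κ * r⁻¹ := mul_nonneg hκ.le (inv_nonneg.2 hr.1.le)
      nlinarith
    · simp
  have hset : ∫ r in Ioo (Real.exp (-1)) 1, stoppedDeriv κ T dF r * r ^ a
      ≤ ∫ r in Ioo (0 : ℝ) 1, stoppedDeriv κ T dF r * r ^ a := by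
    refine setIntegral_mono_set hint ?_ hsub.eventuallyLE
    filter_upwards [hnn, ae_restrict_mem measurableSet_Ioo] with r h hr
    exact mul_nonneg h (Real.rpow_nonneg hr.1.le _)
  refine le_trans ?_ hset
  have hae' := ae_restrict_of_ae_restrict_of_subset hsub hae
  have hnn' := ae_restrict_of_ae_restrict_of_subset hsub hnn
  rcases hcase with hc | ⟨hc, hx⟩
  · refine (min_le_left _ _).trans ?_
    have h1 : ∫ r in Ioo (Real.exp (-1)) 1, κ * m * r ^ (a - 1)
        = κ * m * (1 - Real.exp (-a)) / a := by
      rw [integral_const_mul, integral_Ioo_rpow_sub_one ha he1.le, Real.one_rpow, hea,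
        mul_div_assoc]
    rw [← h1]
    refine setIntegral_mono_ae_restrict
      (((integrableOn_rpow_Ioo (by linarith)).mono_set hsub).const_mul _) (hint.mono_set hsub) ?_
    filter_upwards [hae', ae_restrict_mem measurableSet_Ioo] with r h hr
    have hr0 : 0 < r := he0.trans hr.1
    have hlt : -κ * Real.log r < T := by
      refine lt_of_lt_of_le ((neg_mul_log_lt_iff hκ hr0).2 ?_) hc
      rw [neg_div, div_self hκ.ne']; exact hr.1
    have h2 := h hlt
    rw [stoppedDeriv, if_pos hlt, smul_eq_mul, Real.rpow_sub_one hr0.ne', div_eq_mul_inv]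
    have h3 : 0 ≤ κ * (r ^ a * r⁻¹) := by positivity
    nlinarith
  · refine (min_le_right _ _).trans ?_
    have hK := (integrableOn_stoppedDeriv hκ hdF).mono_set hsub
    have h1 : x ≤ ∫ r in Ioo (Real.exp (-1)) 1, stoppedDeriv κ T dF r := by
      rw [integral_stoppedDeriv hκ ⟨he0, he1⟩, hτ, min_eq_right hc]
      linarith
    calc Real.exp (-a) * x
        ≤ Real.exp (-a) * ∫ r in Ioo (Real.exp (-1)) 1, stoppedDeriv κ T dF r := by gcongr
      _ = ∫ r in Ioo (Real.exp (-1)) 1, Real.exp (-a) * stoppedDeriv κ T dF r :=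
          (integral_const_mul _ _).symm
      _ ≤ _ := by
          refine setIntegral_mono_ae_restrict (hK.const_mul _) (hint.mono_set hsub) ?_
          filter_upwards [hnn', ae_restrict_mem measurableSet_Ioo] with r h hr
          rw [mul_comm, ← hea]
          exact mul_le_mul_of_nonneg_left (Real.rpow_le_rpow he0.le hr.1.le ha.le) h

/-- The kinetic term of a stopped flow is controlled by the dissipated energy. -/
theorem integral_stopped_kinetic_le {E : Type*} [NormedAddCommGroup E] [NormedSpace ℝ E]
    {ψ' : ℝ → E} {C : ℝ} (hC : 0 ≤ C) (hκ : 0 < κ)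
    (h : ∀ᵐ t ∂(volume.restrict (Ioo 0 T)), C * κ * ‖ψ' t‖ ^ 2 ≤ - dF t)
    (hint : IntegrableOn (fun r => stoppedDeriv κ T dF r * r ^ a) (Ioo 0 1)) :
    C * ∫ r in Ioo (0 : ℝ) 1, ‖stoppedDeriv κ T ψ' r‖ ^ 2 * r ^ (a + 1)
      ≤ ∫ r in Ioo (0 : ℝ) 1, stoppedDeriv κ T dF r * r ^ a := by
  rw [← integral_const_mul]
  refine integral_mono_of_nonneg ?_ hint ?_
  · filter_upwards [ae_restrict_mem measurableSet_Ioo] with r hr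
    have := Real.rpow_nonneg hr.1.le (a + 1)
    simp only [Pi.zero_apply]
    positivity
  · filter_upwards [ae_log_subst hκ h, ae_restrict_mem measurableSet_Ioo] with r h1 hr
    simp only [stoppedDeriv]
    split_ifs with hlt
    · have h2 := h1 hlt
      -- The chain rule contributes κ²/r² to the kinetic term but only κ/r to the dissipation; the
      -- extra r in the weight compensates one power and leaves the factor κ of the hypothesis.
      rw [norm_smul, mul_pow, Real.norm_eq_abs, sq_abs, Real.rpow_add_one hr.1.ne', smul_eq_mul]
      have h3 : 0 ≤ κ * r⁻¹ * r ^ a :=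
        mul_nonneg (mul_nonneg hκ.le (inv_nonneg.2 hr.1.le)) (Real.rpow_nonneg hr.1.le a)
      have h4 := mul_le_mul_of_nonneg_left h2 h3
      have h5 : r⁻¹ * r = 1 := inv_mul_cancel₀ hr.1.ne'
      calc C * ((-κ * r⁻¹) ^ 2 * ‖ψ' (-κ * Real.log r)‖ ^ 2 * (r ^ a * r))
          = κ * r⁻¹ * r ^ a * (C * κ * ‖ψ' (-κ * Real.log r)‖ ^ 2) * (r⁻¹ * r) := by ring
        _ ≤ κ * r⁻¹ * r ^ a * -dF (-κ * Real.log r) := by rw [h5, mul_one]; exact h4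
        _ = _ := by ring
    · simp

/-- A decreasing energy stays above half its excess `x` up to a time at which either this half is
attained or the flow ends. -/
theorem exists_stopping_time {Tmax l : ℝ} (hT : 0 ≤ Tmax) (hdF : IntegrableOn dF (Ioo 0 Tmax))
    (hf : ∀ s t, 0 ≤ s → s ≤ t → t ≤ Tmax → f t - f s = ∫ τ in Ioo s t, dF τ)
    (hneg : ∀ᵐ t ∂(volume.restrict (Ioo 0 Tmax)), dF t ≤ 0) (hl : l ≤ f 0) :
    ∃ T ∈ Icc 0 Tmax, (∀ t ∈ Icc 0 T, l ≤ f t) ∧ (T = Tmax ∨ f T = l) := by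
  have hanti : ∀ s t, 0 ≤ s → s ≤ t → t ≤ Tmax → f t ≤ f s := by
    intro s t hs hst ht
    have h : ∫ τ in Ioo s t, dF τ ≤ 0 := integral_nonpos_of_ae
      (ae_restrict_of_ae_restrict_of_subset (Ioo_subset_Ioo hs ht) hneg)
    linarith [hf s t hs hst ht]
  have hcont : ContinuousOn f (Icc 0 Tmax) := by
    have h1 := intervalIntegral.continuousOn_primitive_Icc
      (f := dF) (μ := volume) (a := 0) (b := Tmax) (by rwa [integrableOn_Icc_iff_integrableOn_Ioo])
    refine (h1.const_add (f 0)).congr fun t ht => ?_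
    beta_reduce
    rw [integral_Icc_eq_integral_Ioo, ← hf 0 t le_rfl ht.1 ht.2]
    ring
  by_cases h : l ≤ f Tmax
  · exact ⟨Tmax, ⟨hT, le_rfl⟩, fun t ht => h.trans (hanti t Tmax ht.1 ht.2 le_rfl), Or.inl rfl⟩
  · obtain ⟨T, hT', he⟩ := intermediate_value_Icc' hT hcont ⟨(not_le.1 h).le, hl⟩
    exact ⟨T, hT', fun t ht => he ▸ hanti t T ht.1 ht.2 hT'.2, Or.inr he⟩

/-- Energy dissipation with exponent `p` bounds the speed by the dissipation `D`, when the latter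
is bounded below. -/
theorem sq_le_of_dissipation {n D m p C : ℝ} (hn : 0 ≤ n) (hp : 2 ≤ p) (hC : 0 < C) (hm : 0 < m)
    (hD : m ≤ D) (h : C * min (n ^ 2) (n ^ p) ≤ D) :
    n ^ 2 ≤ D / C * (1 + ((m / C) ^ (1 - 2 / p))⁻¹) := by
  have hD0 : 0 < D := hm.trans_le hD
  have hp0 : 0 < p := by linarith
  have hq : 0 < m / C := div_pos hm hC
  have hDq : 0 < D / C := div_pos hD0 hC
  have hpos : 0 ≤ ((m / C) ^ (1 - 2 / p))⁻¹ := inv_nonneg.2 (Real.rpow_nonneg hq.le _)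
  have hθ : 0 ≤ 1 - 2 / p := by rw [sub_nonneg, div_le_one hp0]; exact hp
  rw [mul_comm, ← le_div_iff₀ hC] at h
  rcases min_le_iff.1 h with h1 | h1
  · nlinarith [mul_nonneg hDq.le hpos]
  -- In the degenerate regime n^p ≤ D/C, one gets n² ≤ (D/C)^(2/p), which is D/C times a nonpositive
  -- power of D/C; the lower bound m ≤ D controls that power.
  · have h2 : n ^ 2 = (n ^ p) ^ (2 / p) := by
      rw [← Real.rpow_mul hn, mul_div_cancel₀ _ hp0.ne']; norm_cast
    have h3 : (D / C) ^ (2 / p) = D / C * ((D / C) ^ (1 - 2 / p))⁻¹ := by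
      rw [← Real.rpow_neg hDq.le, ← Real.rpow_one_add' hDq.le]
      · congr 1; ring
      · rw [show 1 + -(1 - 2 / p) = 2 / p by ring]; positivity
    have h4 : ((D / C) ^ (1 - 2 / p))⁻¹ ≤ ((m / C) ^ (1 - 2 / p))⁻¹ := by
      gcongr
    calc n ^ 2 ≤ (D / C) ^ (2 / p) := by
          rw [h2]; exact Real.rpow_le_rpow (Real.rpow_nonneg hn _) h1 (by positivity)
      _ ≤ D / C * ((m / C) ^ (1 - 2 / p))⁻¹ := by rw [h3]; gcongr
      _ ≤ _ := by nlinarith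

end energy

/-! ### The energy improvement. -/

section epiperimetric

/-- The improvement of energy along the stopped flow, for an initial excess `x = 𝓕(c) - 𝓕(S)` in
`(0,1]`; the ratio of time scales is `κ = k q^(1-2/p)`, where `q C_ED` is the dissipation rate
given by the Łojasiewicz inequality. -/
theorem stopped_flow_energy_le {d : ℕ} (hd : 2 ≤ d) {α p β Tmax CSL CLS CED a k q x : ℝ}
    (hα : 0 < α) (hp : 2 ≤ p) (hβ₀ : 0 ≤ β) (hT : 0 < Tmax) (hCSL : 0 < CSL) (hCLS : 0 < CLS)
    (hCED : 0 < CED) (ha : a = 2 * α + d - 2) (hk : 0 < k)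
    (hk₁ : 2 * a * CSL * k * (2 + CLS / CED) ≤ CED) (hk₂ : k * (1 + CLS / CED) ≤ Tmax)
    (hx : 0 < x) (hx₁ : x ≤ 1) (hq : q = CLS / CED * (x / 2) ^ (1 + β))
    {G : H1Ball d → ℝ} {F : H1Sph d → ℝ} {gradF : H2Sph d → L2Sph d} {FS : ℝ}
    {ψ : ℝ → H1Sph d} {ψ' : ℝ → L2Sph d} {dF : ℝ → ℝ} (hS : Slicing α CSL G F)
    (hflow : IsFlow F gradF Tmax ψ ψ' dF) (hED : EnergyDissipation CED p Tmax ψ' dF)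
    (hLS : Lojasiewicz CLS β Tmax F FS ψ dF) (h0 : F (ψ 0) - FS = x) :
    ∃ h : H1Ball d, HasTrace h (toL2 (ψ 0)) ∧
      (∃ κ : ℝ, 0 < κ ∧ ∃ T ∈ Icc 0 Tmax,
        EqPolar h α (fun r => ψ (min (-κ * Real.log r) T))) ∧
      G h - FS / a ≤ x / a - min (k * CED * q ^ (2 - 2 / p) * (1 - Real.exp (-a)) / a)
        (Real.exp (-a) * (x / 2)) / (2 * a) := by
  have hd2 : (2 : ℝ) ≤ d := by exact_mod_cast hd
  have ha0 : 0 < a := by rw [ha]; linarith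
  have hθ : 0 ≤ 1 - 2 / p := by rw [sub_nonneg, div_le_one (by linarith)]; exact hp
  have hθ1 : 1 - 2 / p ≤ 1 := by rw [sub_le_self_iff]; positivity
  have hq0 : 0 < q := by rw [hq]; positivity
  have hqle : q ≤ CLS / CED := by
    rw [hq]
    exact mul_le_of_le_one_right (by positivity)
      (Real.rpow_le_one (by linarith) (by linarith) (by linarith))
  -- Since q may lie on either side of 1, the base is raised to 1 + q before the exponent is raised
  -- to 1.
  have hqθ : q ^ (1 - 2 / p) ≤ 1 + CLS / CED := by
    calc q ^ (1 - 2 / p) ≤ (1 + q) ^ (1 - 2 / p) :=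
          Real.rpow_le_rpow hq0.le (by linarith) hθ
      _ ≤ (1 + q) ^ (1 : ℝ) := Real.rpow_le_rpow_of_exponent_le (by linarith) hθ1
      _ ≤ 1 + CLS / CED := by rw [Real.rpow_one]; linarith
  have hqθ0 : 0 < q ^ (1 - 2 / p) := Real.rpow_pos_of_pos hq0 _
  set κ := k * q ^ (1 - 2 / p) with hκdef
  have hκ : 0 < κ := mul_pos hk hqθ0
  have hκT : κ ≤ Tmax := (mul_le_mul_of_nonneg_left hqθ hk.le).trans hk₂
  set m := CED * q with hmdef
  have hm : 0 < m := mul_pos hCED hq0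
  have hneg : ∀ᵐ t ∂(volume.restrict (Ioo 0 Tmax)), dF t ≤ 0 := by
    filter_upwards [hED] with t ht
    have : 0 ≤ CED * min (‖ψ' t‖ ^ 2) (‖ψ' t‖ ^ p) := by positivity
    linarith
  obtain ⟨T, hTm, hTf, hTe⟩ := exists_stopping_time (f := fun t => F (ψ t)) (l := FS + x / 2) hT.le
    hflow.integrable_dF hflow.energy_deriv hneg (by linarith)
  have hsub : Ioo 0 T ⊆ Ioo 0 Tmax := Ioo_subset_Ioo_right hTm.2
  have hdFT := hflow.integrable_dF.mono_set hsub
  have hdm : ∀ᵐ t ∂(volume.restrict (Ioo 0 T)), m ≤ - dF t := by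
    filter_upwards [ae_restrict_of_ae_restrict_of_subset hsub hLS,
      ae_restrict_mem measurableSet_Ioo] with t h1 ht
    have h2 : FS + x / 2 ≤ F (ψ t) := hTf t ⟨ht.1.le, ht.2.le⟩
    calc m = CLS * (x / 2) ^ (1 + β) := by rw [hmdef, hq]; field_simp
      _ ≤ CLS * (F (ψ t) - FS) ^ (1 + β) := by
        gcongr
        linarith
      _ ≤ - dF t := h1 (by linarith)
  have hkin : ∀ᵐ t ∂(volume.restrict (Ioo 0 T)), 2 * a * CSL * κ * ‖ψ' t‖ ^ 2 ≤ - dF t := by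
    filter_upwards [ae_restrict_of_ae_restrict_of_subset hsub hED, hdm] with t h1 h2
    have h3 := sq_le_of_dissipation (norm_nonneg _) hp hCED hm h2 h1
    have hD : 0 ≤ - dF t := hm.le.trans h2
    have h4 : m / CED = q := by rw [hmdef]; field_simp
    rw [h4] at h3
    calc 2 * a * CSL * κ * ‖ψ' t‖ ^ 2
        ≤ 2 * a * CSL * κ * (- dF t / CED * (1 + (q ^ (1 - 2 / p))⁻¹)) := by gcongr
      _ = - dF t / CED * (2 * a * CSL * k * (q ^ (1 - 2 / p) + 1)) := by
          rw [hκdef]; field_simp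
      _ ≤ - dF t / CED * (2 * a * CSL * k * (2 + CLS / CED)) := by
          gcongr - dF t / CED * (2 * a * CSL * k * ?_)
          linarith
      _ ≤ - dF t / CED * CED := by gcongr
      _ = - dF t := by field_simp
  have hf0 : ∀ t, 0 ≤ t → t ≤ T → F (ψ t) - F (ψ 0) = ∫ τ in Ioo 0 t, dF τ :=
    fun t ht0 htT => hflow.energy_deriv 0 t le_rfl ht0 (htT.trans hTm.2)
  obtain ⟨i1, i2, e⟩ := integral_stopped_energy (f := fun t => F (ψ t)) ha0 hκ hTm.1 hdFT hf0
  have hmono : volume.restrict (Ioo 0 T) ≤ volume.restrict (Ioo 0 Tmax) :=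
    Measure.restrict_mono hsub le_rfl
  obtain ⟨hcyl, h, hpol, htr⟩ := stopped_flow_extension hd hα hκ hTm.1
    (hflow.memLp.mono_measure hmono) (hflow.memLp_deriv.mono_measure hmono)
    (fun t ht0 htT => hflow.deriv 0 t le_rfl ht0 (htT.trans hTm.2))
  refine ⟨h, htr, ⟨κ, hκ, T, hTm, hpol⟩, ?_⟩
  have e1 : 2 * α + d - 3 = a - 1 := by rw [ha]; ring
  have e2 : 2 * α + d - 1 = a + 1 := by rw [ha]; ring
  have hG := hS.le _ _ hcyl (by rw [e1]; exact i1) h hpol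
  rw [e1, e2] at hG
  have hK := integral_stopped_kinetic_le (C := 2 * a * CSL) (by positivity) hκ hkin i2
  -- If T < κ ≤ Tmax, the flow was not stopped by the end of its interval, so it has lost exactly
  -- x/2.
  have hL := le_integral_stopped_dissipation (x := x / 2) ha0 hκ hdFT hm.le hdm (by
    rcases le_or_gt κ T with hc | hc
    · exact Or.inl hc
    · refine Or.inr ⟨hc.le, ?_⟩
      rcases hTe with h1 | h1
      · linarith
      · rw [← hf0 T hTm.1 le_rfl]; linarith) i2
  have hκm : κ * m = k * CED * q ^ (2 - 2 / p) := by
    have : q ^ (2 - 2 / p) = q * q ^ (1 - 2 / p) := by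
      rw [← Real.rpow_one_add' hq0.le (by linarith)]; congr 1; ring
    rw [this, hκdef, hmdef]; ring
  rw [hκm] at hL
  set I := ∫ r in Ioo (0 : ℝ) 1, stoppedDeriv κ T dF r * r ^ a
  set N := ∫ r in Ioo (0 : ℝ) 1, ‖stoppedDeriv κ T ψ' r‖ ^ 2 * r ^ (a + 1)
  -- The kinetic term consumes at most half of the gain I/a; the other half is the improvement.
  have hN : CSL * N ≤ I / (2 * a) := by
    rw [le_div_iff₀ (by positivity)]; linarith
  have hI : min (k * CED * q ^ (2 - 2 / p) * (1 - Real.exp (-a)) / a)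
      (Real.exp (-a) * (x / 2)) / (2 * a) ≤ I / (2 * a) := by gcongr
  have e3 : F (ψ 0) = FS + x := by linarith
  have e4 : (F (ψ 0) - I) / a = FS / a + x / a - 2 * (I / (2 * a)) := by
    rw [e3]; field_simp
  linarith [hG, e, e4]

/-- The `α`-homogeneous extension `r^α c` of `c` is in `H¹(B₁)` and has trace `c`. -/
theorem exists_constant_extension {d : ℕ} (hd : 2 ≤ d) {α : ℝ} (hα : 0 < α) (c : H1Sph d) :
    ∃ z : H1Ball d, EqPolar z α (fun _ => c) ∧ HasTrace z (toL2 c) := by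
  obtain ⟨-, z, hz, ht⟩ := stopped_flow_extension (ψ := fun _ => c) (ψ' := fun _ => 0) hd hα
    one_pos le_rfl (memLp_const (μ := volume.restrict (Ioo 0 0)) c) (memLp_const 0)
    (fun t _ _ => by simp)
  exact ⟨z, hz, ht⟩

end epiperimetric

end LogEpi

/-! ### The logarithmic epiperimetric inequality. -/

open LogEpi
theorem theoremA1 (d : ℕ) (hd : 2 ≤ d) (α p β Tmax CSL CLS CED : ℝ)
    (hα : 0 < α) (hp : 2 ≤ p) (hβ₀ : 0 ≤ β) (hβ₁ : β < 1) (hT : 0 < Tmax)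
    (hCSL : 0 < CSL) (hCLS : 0 < CLS) (hCED : 0 < CED)
    (hpβ : (1 + β) * (1 - 1 / p) < 1) :
    ∃ E γ ε : ℝ, 0 < E ∧ 0 ≤ γ ∧ γ < 1 ∧ γ = (1 + β) * (2 - 2 / p) - 1 ∧ 0 < ε ∧
      ∀ (G : H1Ball d → ℝ) (F : H1Sph d → ℝ) (gradF : H2Sph d → L2Sph d)
        (S : Set (H2Sph d)) (FS : ℝ)
        (ψ : ℝ → H1Sph d) (ψ' : ℝ → L2Sph d) (dF : ℝ → ℝ),
        HasL2Gradient F gradF →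
        Slicing α CSL G F →
        IsCriticalSet F gradF S FS →
        IsFlow F gradF Tmax ψ ψ' dF →
        EnergyDissipation CED p Tmax ψ' dF →
        Lojasiewicz CLS β Tmax F FS ψ dF →
        ∀ c : H1Sph d, c = ψ 0 → F c - FS ≤ E →
          ∃ z : H1Ball d, EqPolar z α (fun _ => c) ∧
          ∃ h : H1Ball d, HasTrace h (toL2 c) ∧
            (∃ κ : ℝ, 0 < κ ∧ ∃ T ∈ Set.Icc 0 Tmax,
              EqPolar h α (fun r => ψ (min (-κ * Real.log r) T))) ∧
            G h - FS / (2 * α + d - 2) ≤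
              (1 - ε * |G z - FS / (2 * α + d - 2)| ^ γ) * (G z - FS / (2 * α + d - 2)) := by
  have hd2 : (2 : ℝ) ≤ d := by exact_mod_cast hd
  obtain ⟨a, ha⟩ : ∃ a : ℝ, a = 2 * α + d - 2 := ⟨_, rfl⟩
  have ha0 : 0 < a := by rw [ha]; linarith
  have hp0 : 0 < p := by linarith
  have h2p : 2 / p ≤ 1 := by rw [div_le_one hp0]; exact hp
  have h12 : 2 / p = 2 * (1 / p) := by ring
  obtain ⟨γ, hγ⟩ : ∃ γ : ℝ, γ = (1 + β) * (2 - 2 / p) - 1 := ⟨_, rfl⟩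
  have hγ0 : 0 ≤ γ := by rw [hγ]; nlinarith
  have hγ1 : γ < 1 := by rw [hγ, h12]; nlinarith
  -- The first bound on k lets dissipation absorb the kinetic term, the second ensures κ ≤ Tmax.
  obtain ⟨k, hk0, hk₁, hk₂⟩ : ∃ k : ℝ, 0 < k ∧ 2 * a * CSL * k * (2 + CLS / CED) ≤ CED ∧
      k * (1 + CLS / CED) ≤ Tmax := by
    refine ⟨min (CED / (2 * a * CSL * (2 + CLS / CED))) (Tmax / (1 + CLS / CED)),
      by positivity, ?_, ?_⟩
    · calc _ = min (CED / (2 * a * CSL * (2 + CLS / CED))) (Tmax / (1 + CLS / CED))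
            * (2 * a * CSL * (2 + CLS / CED)) := by ring
        _ ≤ _ := (le_div_iff₀ (by positivity)).1 (min_le_left _ _)
    · exact (le_div_iff₀ (by positivity)).1 (min_le_right _ _)
  have hexp : Real.exp (-a) < 1 := Real.exp_lt_one_iff.2 (by linarith)
  -- A and B are the coefficients of x^(1+γ) and of x in the two alternatives for the gain.
  set A : ℝ := k * CED * (CLS / CED * (1 / 2) ^ (1 + β)) ^ (2 - 2 / p) * (1 - Real.exp (-a)) / a
    with hA
  have hA0 : 0 < A := by
    have : 0 < 1 - Real.exp (-a) := by linarith
    rw [hA]; positivity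
  set B : ℝ := Real.exp (-a) / 2 with hB
  have hB0 : 0 < B := by rw [hB]; positivity
  -- E = 1 is what gives x^(1+γ) ≤ x. The factor a^γ in ε converts powers of 𝓖(z) - 𝓖(S) = x/a into
  -- powers of x.
  refine ⟨1, γ, min A B * a ^ γ / 2, one_pos, hγ0, hγ1, hγ, by positivity, ?_⟩
  intro G F gradF S FS ψ ψ' dF _ hS _ hflow hED hLS c hc hE
  obtain ⟨z, hz, hzt⟩ := exists_constant_extension hd hα c
  refine ⟨z, hz, ?_⟩
  obtain ⟨x, hx⟩ : ∃ x, x = F c - FS := ⟨_, rfl⟩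
  have e1 : 2 * α + d - 3 = a - 1 := by rw [ha]; ring
  have hconst : ∀ h : H1Ball d, EqPolar h α (fun _ => c) → G h - FS / a = x / a := by
    intro h hh
    rw [hS.eq_of_const c h hh, e1, integral_const_mul, integral_Ioo_rpow_sub_one ha0 zero_le_one,
      Real.one_rpow, Real.zero_rpow ha0.ne', hx]
    ring
  rw [← ha, hconst z hz]
  rcases le_or_gt x 0 with hx0 | hx0
  -- For a nonpositive excess take h = z, with T = 0: subtracting ε|x/a|^γ times x/a can only
  -- increase the right-hand side.
  · refine ⟨z, hzt, ⟨1, one_pos, 0, ⟨le_rfl, hT.le⟩, ?_⟩, ?_⟩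
    · filter_upwards [hz, ae_restrict_mem measurableSet_Ioo] with r h1 hr
      rwa [min_eq_right (neg_mul_log_pos one_pos hr).le, ← hc]
    · rw [hconst z hz]
      have h1 : 0 ≤ min A B * a ^ γ / 2 * |x / a| ^ γ := by positivity
      have h2 : x / a ≤ 0 := div_nonpos_of_nonpos_of_nonneg hx0 ha0.le
      nlinarith
  · have hx1 : x ≤ 1 := by linarith
    subst hc
    obtain ⟨h, htr, hform, hle⟩ := stopped_flow_energy_le hd hα hp hβ₀ hT hCSL hCLS hCED ha hk0
      hk₁ hk₂ hx0 hx1 rfl hS hflow hED hLS hx.symm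
    refine ⟨h, htr, hform, hle.trans ?_⟩
    have hq : (CLS / CED * (x / 2) ^ (1 + β)) ^ (2 - 2 / p)
        = (CLS / CED * (1 / 2) ^ (1 + β)) ^ (2 - 2 / p) * x ^ (1 + γ) := by
      rw [div_eq_mul_one_div x 2, mul_comm x, Real.mul_rpow (by norm_num) hx0.le, ← mul_assoc,
        Real.mul_rpow (by positivity) (by positivity), ← Real.rpow_mul hx0.le]
      congr 2
      rw [hγ]; ring
    have hxγ : x ^ (1 + γ) ≤ x := by
      calc x ^ (1 + γ) ≤ x ^ (1 : ℝ) :=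
            Real.rpow_le_rpow_of_exponent_ge hx0 hx1 (by linarith)
        _ = x := Real.rpow_one x
    have hxγ0 : 0 < x ^ (1 + γ) := Real.rpow_pos_of_pos hx0 _
    have hmin : min A B * x ^ (1 + γ) ≤ min
        (k * CED * (CLS / CED * (x / 2) ^ (1 + β)) ^ (2 - 2 / p) * (1 - Real.exp (-a)) / a)
        (Real.exp (-a) * (x / 2)) := by
      refine le_min ?_ ?_
      · calc min A B * x ^ (1 + γ) ≤ A * x ^ (1 + γ) := by gcongr; exact min_le_left _ _
          _ = _ := by rw [hq, hA]; ring
      · calc min A B * x ^ (1 + γ) ≤ B * x := by gcongr; exact min_le_right _ _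
          _ = _ := by rw [hB]; ring
    have hgain : min A B * a ^ γ / 2 * |x / a| ^ γ * (x / a)
        = min A B * x ^ (1 + γ) / (2 * a) := by
      rw [abs_of_pos (by positivity), Real.div_rpow hx0.le ha0.le,
        Real.rpow_one_add' hx0.le (by linarith)]
      field_simp
    have hdiv : min A B * x ^ (1 + γ) / (2 * a) ≤ min
        (k * CED * (CLS / CED * (x / 2) ^ (1 + β)) ^ (2 - 2 / p) * (1 - Real.exp (-a)) / a)
        (Real.exp (-a) * (x / 2)) / (2 * a) := by gcongr
    linarith
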